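/- Let $0<\alpha<1/3$. Let $p_1=(0,0)$, $p_2=(\tfrac12,\tfrac{\sqrt3}{2})$, $p_3=(1,0)$, $p_4=\tfrac{p_2+p_3}{2}$, $p_5=\tfrac{p_1+p_3}{2}$, $p_6=\tfrac{p_1+p_2}{2}$ and let $F_j:\mathbb R^2\to\mathbb R^2$, $F_j(x)=A_j(x-p_j)+p_j$, where $$A_1=A_2=A_3=\tfrac{1-\alpha}{2}I,\quad A_4=\tfrac{\alpha}{4}\begin{pmatrix}1&-\sqrt3\\-\sqrt3&3\end{pmatrix},\quad A_5=\alpha\begin{pmatrix}1&0\\0&0\end{pmatrix},\quad A_6=\tfrac{\alpha}{4}\begin{pmatrix}1&\sqrt3\\\sqrt3&3\end{pmatrix}.$$ The stretched Sierpinski gasket $K_\alpha$ is the unique non-empty compact set $K_\alpha\subset\mathbb R^2$ with $K_\alpha=\bigcup_{j=1}^6F_j(K_\alpha)$. Let $\mathscr E$ be the set of all segments of the following two kinds, where $w=w_1\cdots w_n$ runs through the finite words (including the empty one) over $\{1,2,3\}$ and $F_w=F_{w_n}\circ\cdots\circ F_{w_1}$: the three sides of the triangle with vertices $F_w(p_1),F_w(p_2),F_w(p_3)$,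 and the three joining edges $F_w(F_{3+i}(\Delta))$, $i=1,2,3$, where $\Delta$ is the triangle with vertices $p_1,p_2,p_3$. All these segments lie in $K_\alpha$. For $\varepsilon\in\mathscr E$ of length $\ell$ let $R_\varepsilon:[0,\ell]\to K_\alpha$ be its parametrization by arc length. The spectral triple of the curve $R_\varepsilon$ consists of $C(K_\alpha)$, the Hilbert space $\mathcal H_\varepsilon=L^2([-\ell,\ell],(2\ell)^{-1}dx)$, the representation $(\pi_\varepsilon(f)h)(x)=f(R_\varepsilon(|x|))\,h(x)$, and the operator $D_\varepsilon=D+\frac{\pi}{2\ell}I$, where $D$ is the closure of $-i\frac{d}{dx}$ on the linear span of the functions $e^{i\pi kx/\ell}$, $k\in\mathbb Z$. Let $$S(K_\alpha)=\Big(C(K_\alpha),\ \bigoplus_{\varepsilon\in\mathscr E}\mathcal H_\varepsilon,\ D_\alpha=\bigoplus_{\varepsilon\in\mathscr E}D_\varepsilon\Big)$$ be the direct sum of these triples, with representation $\bigoplus_\varepsilon\pi_\varepsilon$. Then the spectral dimension $\inf\{p>0:\operatorname{tr}((I+D_\alpha^2)^{-p/2})<\infty\}$ of $S(K_\alpha)$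 equals $$d_\alpha=\frac{\log3}{\log2-\log(1-\alpha)},$$ and $d_\alpha$ is the Hausdorff dimension of $K_\alpha$ (with the Euclidean metric). -/

import Mathlib

open scoped NNReal ENNReal Matrix InnerProductSpace

noncomputable section

/-! ### Spectral triples and their dimension -/

/-- The constituents of a spectral triple `(A, H, D)`: a representation of the algebra `A` on the
Hilbert space `H` and a (possibly unbounded) operator `D` in `H`. -/
structure SpectralTripleData (A H : Type*) [Ring A] [StarRing A] [Algebra ℂ A]
    [NormedAddCommGroup H] [InnerProductSpace ℂ H] [CompleteSpace H] where
  /-- the representation `π` -/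
  rep : A →⋆ₐ[ℂ] (H →L[ℂ] H)
  /-- the operator `D` -/
  dirac : H →ₗ.[ℂ] H

/-- The bounded operator `T` is `(I + D²)⁻¹`: `T z = x` holds exactly when `x` is in the domain of
`D²` and `x + D² x = z`. -/
def IsInvOneAddSq {H : Type*} [NormedAddCommGroup H] [InnerProductSpace ℂ H]
    (D : H →ₗ.[ℂ] H) (T : H →L[ℂ] H) : Prop :=
  ∀ x z : H, T z = x ↔
    ∃ (hx : x ∈ D.domain) (hDx : D ⟨x, hx⟩ ∈ D.domain), x + D ⟨D ⟨x, hx⟩, hDx⟩ = z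

/-- The trace `∑ ⟨b_i, T b_i⟩` of a positive bounded operator, with values in `[0, ∞]`; it does not
depend on the orthonormal basis. -/
def posTrace {H : Type*} [NormedAddCommGroup H] [InnerProductSpace ℂ H] [CompleteSpace H]
    (T : H →L[ℂ] H) : ℝ≥0∞ :=
  ∑' i : (exists_hilbertBasis ℂ H).choose,
    ENNReal.ofReal (RCLike.re ⟪((exists_hilbertBasis ℂ H).choose_spec.choose i : H),
      T ((exists_hilbertBasis ℂ H).choose_spec.choose i)⟫_ℂ)

/-- The spectral dimension `inf {p > 0 : tr ((I + D²) ^ (-p / 2)) < ∞}`, with `inf ∅ = ∞`. -/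
def SpectralTripleData.dimension {A H : Type*} [Ring A] [StarRing A] [Algebra ℂ A]
    [NormedAddCommGroup H] [InnerProductSpace ℂ H] [CompleteSpace H]
    (S : SpectralTripleData A H) : ℝ≥0∞ :=
  sInf {d | ∃ p : ℝ, 0 < p ∧ d = ENNReal.ofReal p ∧
    ∃ T : H →L[ℂ] H, IsInvOneAddSq S.dirac T ∧ posTrace (T ^ (p / 2)) < ∞}

/-! ### The spectral triple of a curve and direct sums -/

/-- Normalized Lebesgue measure on `[-ℓ, ℓ]`. -/
def curveMeasure (ℓ : ℝ) : MeasureTheory.Measure ℝ :=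
  ENNReal.ofReal (1 / (2 * ℓ)) • MeasureTheory.volume.restrict (Set.Icc (-ℓ) ℓ)

instance instIsFiniteMeasureCurveMeasure (ℓ : ℝ) :
    MeasureTheory.IsFiniteMeasure (curveMeasure ℓ) := by
  unfold curveMeasure
  exact MeasureTheory.Measure.smul_finite _ ENNReal.ofReal_ne_top

/-- The Hilbert space `L²([-ℓ, ℓ], (2ℓ)⁻¹ m)`. -/
abbrev CurveSpace (ℓ : ℝ) : Type := MeasureTheory.Lp ℂ 2 (curveMeasure ℓ)

/-- The functions `φ_k(x) = exp (i π k x / ℓ)`. -/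
def trig (ℓ : ℝ) (k : ℤ) (x : ℝ) : ℂ := Complex.exp (Complex.I * Real.pi * k * x / ℓ)

/-- The operator `-i d/dx` on the linear span of the `φ_k`, given by its graph. -/
def curveCore (ℓ : ℝ) : CurveSpace ℓ →ₗ.[ℂ] CurveSpace ℓ :=
  (Submodule.span ℂ {q : CurveSpace ℓ × CurveSpace ℓ | ∃ k : ℤ,
    q.1 =ᵐ[curveMeasure ℓ] trig ℓ k ∧
    q.2 =ᵐ[curveMeasure ℓ] fun x => -Complex.I * deriv (trig ℓ k) x}).toLinearPMap

/-- The operator `D_ℓ = D + π / (2ℓ)`, where `D` is the closure of `-i d/dx` on the span of the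
`φ_k`. -/
def curveDirac (ℓ : ℝ) : CurveSpace ℓ →ₗ.[ℂ] CurveSpace ℓ :=
  (((Real.pi / (2 * ℓ) : ℝ) : ℂ) • (LinearMap.id : CurveSpace ℓ →ₗ[ℂ] CurveSpace ℓ)) +ᵥ
    (curveCore ℓ).closure

/-- The bounded continuous function `x ↦ f (R |x|)`. -/
def pullback {X : Type*} [TopologicalSpace X] [CompactSpace X] (R : C(ℝ, X)) (f : C(X, ℂ)) :
    BoundedContinuousFunction ℝ ℂ :=
  (BoundedContinuousFunction.mkOfCompact f).compContinuous
    ⟨fun x => R |x|, R.continuous.comp continuous_abs⟩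

/-- Multiplication by `x ↦ f (R |x|)` on `L²([-ℓ, ℓ], (2ℓ)⁻¹ m)`. -/
def curveMul {X : Type*} [TopologicalSpace X] [CompactSpace X] (ℓ : ℝ) (R : C(ℝ, X))
    (f : C(X, ℂ)) : CurveSpace ℓ →L[ℂ] CurveSpace ℓ :=
  (ContinuousLinearMap.mul ℂ ℂ).holderL (curveMeasure ℓ) ∞ 2 2
    (BoundedContinuousFunction.toLp ∞ (curveMeasure ℓ) ℂ (pullback R f))

theorem curveMul_coe {X : Type*} [TopologicalSpace X] [CompactSpace X] (ℓ : ℝ) (R : C(ℝ, X))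
    (f : C(X, ℂ)) (h : CurveSpace ℓ) :
    curveMul ℓ R f h =ᵐ[curveMeasure ℓ] fun x => f (R |x|) * h x := by
  have h1 := (ContinuousLinearMap.mul ℂ ℂ).coeFn_holder (r := 2)
    (BoundedContinuousFunction.toLp ∞ (curveMeasure ℓ) ℂ (pullback R f)) h
  have h2 := BoundedContinuousFunction.coeFn_toLp ∞ (curveMeasure ℓ) ℂ (pullback R f)
  filter_upwards [h1, h2] with x hx1 hx2
  refine hx1.trans ?_
  rw [hx2]
  rfl

theorem norm_curveMul_le {X : Type*} [TopologicalSpace X] [CompactSpace X] (ℓ : ℝ) (R : C(ℝ, X))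
    (f : C(X, ℂ)) (h : CurveSpace ℓ) : ‖curveMul ℓ R f h‖ ≤ ‖f‖ * ‖h‖ := by
  refine MeasureTheory.Lp.norm_le_mul_norm_of_ae_le_mul ?_
  filter_upwards [curveMul_coe ℓ R f h] with x hx
  rw [hx, norm_mul]
  exact mul_le_mul_of_nonneg_right (f.norm_coe_le_norm _) (norm_nonneg _)

/-- The Hilbert direct sum of the spaces of curves of lengths `ℓ_e`. -/
abbrev CurveSum {ι : Type*} (ℓ : ι → ℝ) : Type _ := lp (fun e => CurveSpace (ℓ e)) 2

theorem memℓp_curveMul {ι X : Type*} [TopologicalSpace X] [CompactSpace X] (ℓ : ι → ℝ)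
    (R : ι → C(ℝ, X)) (f : C(X, ℂ)) (h : CurveSum ℓ) :
    Memℓp (fun e => curveMul (ℓ e) (R e) f (h e)) 2 := by
  have h0 : Memℓp (fun e => (‖f‖ : ℂ) • h e) 2 := (lp.memℓp h).const_smul (‖f‖ : ℂ)
  refine h0.mono' fun e => ?_
  rw [norm_smul, Complex.norm_real, norm_norm]
  exact norm_curveMul_le _ _ _ _

/-- The direct sum of the multiplication operators on the spaces of the curves. -/
def sumMul {ι X : Type*} [TopologicalSpace X] [CompactSpace X] (ℓ : ι → ℝ) (R : ι → C(ℝ, X))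
    (f : C(X, ℂ)) : CurveSum ℓ →L[ℂ] CurveSum ℓ :=
  LinearMap.mkContinuous
    { toFun := fun h => ⟨fun e => curveMul (ℓ e) (R e) f (h e), memℓp_curveMul ℓ R f h⟩
      map_add' := fun h₁ h₂ => lp.ext (funext fun e => map_add (curveMul (ℓ e) (R e) f) _ _)
      map_smul' := fun c h => lp.ext (funext fun e => map_smul (curveMul (ℓ e) (R e) f) c _) }
    ‖f‖ (fun h => by
      have h1 : ‖((‖f‖ : ℂ) • h : CurveSum ℓ)‖ = ‖f‖ * ‖h‖ := by
        rw [norm_smul, Complex.norm_real, norm_norm]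
      rw [← h1]
      refine lp.norm_mono (by norm_num) fun e => ?_
      refine (norm_curveMul_le _ _ _ _).trans (le_of_eq ?_)
      change _ = ‖(‖f‖ : ℂ) • h e‖
      rw [norm_smul, Complex.norm_real, norm_norm])

theorem sumMul_apply {ι X : Type*} [TopologicalSpace X] [CompactSpace X] (ℓ : ι → ℝ)
    (R : ι → C(ℝ, X)) (f : C(X, ℂ)) (h : CurveSum ℓ) (e : ι) :
    sumMul ℓ R f h e = curveMul (ℓ e) (R e) f (h e) := rfl

theorem curveMul_ext {X : Type*} [TopologicalSpace X] [CompactSpace X] {ℓ : ℝ} {R : C(ℝ, X)}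
    {f : C(X, ℂ)} {h g : CurveSpace ℓ}
    (hg : g =ᵐ[curveMeasure ℓ] fun x => f (R |x|) * h x) : curveMul ℓ R f h = g :=
  MeasureTheory.Lp.ext ((curveMul_coe ℓ R f h).trans hg.symm)

theorem inner_curveMul {X : Type*} [TopologicalSpace X] [CompactSpace X] {ℓ : ℝ} {R : C(ℝ, X)}
    {f : C(X, ℂ)} (h g : CurveSpace ℓ) :
    ⟪curveMul ℓ R (star f) h, g⟫_ℂ = ⟪h, curveMul ℓ R f g⟫_ℂ := by
  rw [MeasureTheory.L2.inner_def, MeasureTheory.L2.inner_def]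
  refine MeasureTheory.integral_congr_ae ?_
  filter_upwards [curveMul_coe ℓ R (star f) h, curveMul_coe ℓ R f g] with x hx hx'
  rw [hx, hx']
  simp
  ring

/-- The direct sum of the representations `π_ℓ(f) h(x) = f(R|x|) h(x)` of `C(X)`. -/
def sumRep {ι X : Type*} [TopologicalSpace X] [CompactSpace X] (ℓ : ι → ℝ) (R : ι → C(ℝ, X)) :
    C(X, ℂ) →⋆ₐ[ℂ] (CurveSum ℓ →L[ℂ] CurveSum ℓ) where
  toFun := sumMul ℓ R
  map_one' := by
    refine ContinuousLinearMap.ext fun h => lp.ext (funext fun e => ?_)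
    exact curveMul_ext (by simp)
  map_zero' := by
    refine ContinuousLinearMap.ext fun h => lp.ext (funext fun e => ?_)
    refine curveMul_ext ?_
    filter_upwards [MeasureTheory.Lp.coeFn_zero ℂ 2 (curveMeasure (ℓ e))] with x hx
    simpa using hx
  map_mul' f g := by
    refine ContinuousLinearMap.ext fun h => lp.ext (funext fun e => ?_)
    refine curveMul_ext ?_
    filter_upwards [curveMul_coe (ℓ e) (R e) f (curveMul (ℓ e) (R e) g (h e)),
      curveMul_coe (ℓ e) (R e) g (h e)] with x hx hx'
    refine hx.trans ?_
    rw [hx', ContinuousMap.mul_apply, mul_assoc]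
  map_add' f g := by
    refine ContinuousLinearMap.ext fun h => lp.ext (funext fun e => ?_)
    refine curveMul_ext ?_
    filter_upwards [MeasureTheory.Lp.coeFn_add (curveMul (ℓ e) (R e) f (h e))
      (curveMul (ℓ e) (R e) g (h e)), curveMul_coe (ℓ e) (R e) f (h e),
      curveMul_coe (ℓ e) (R e) g (h e)] with x hx hf hg
    refine hx.trans ?_
    rw [Pi.add_apply, hf, hg, ContinuousMap.add_apply, add_mul]
  commutes' c := by
    refine ContinuousLinearMap.ext fun h => lp.ext (funext fun e => ?_)
    refine curveMul_ext ?_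
    filter_upwards [MeasureTheory.Lp.coeFn_smul c (h e)] with x hx
    refine hx.trans ?_
    simp [Algebra.algebraMap_eq_smul_one]
  map_star' f := by
    rw [ContinuousLinearMap.star_eq_adjoint, ContinuousLinearMap.eq_adjoint_iff]
    intro h g
    rw [lp.inner_eq_tsum, lp.inner_eq_tsum]
    exact tsum_congr fun e => inner_curveMul _ _

/-- The direct sum of operators: `x` is in its domain and is mapped to `y` when each `x_e` is in
the domain of `D_e` and is mapped to `y_e`, where `x` and `y` are in the Hilbert direct sum. -/
def sumDirac {ι : Type*} (ℓ : ι → ℝ) : CurveSum ℓ →ₗ.[ℂ] CurveSum ℓ :=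
  Submodule.toLinearPMap
    { carrier := {q | ∀ e, (q.1 e, q.2 e) ∈ (curveDirac (ℓ e)).graph}
      zero_mem' := fun e => (curveDirac (ℓ e)).graph.zero_mem
      add_mem' := fun ha hb e => (curveDirac (ℓ e)).graph.add_mem (ha e) (hb e)
      smul_mem' := fun c _ ha e => (curveDirac (ℓ e)).graph.smul_mem c (ha e) }

/-- The direct sum of the spectral triples of the curves `R_e : [0, ℓ_e] → X`. -/
def curveTriple {ι X : Type*} [TopologicalSpace X] [CompactSpace X] (ℓ : ι → ℝ)
    (R : ι → C(ℝ, X)) : SpectralTripleData C(X, ℂ) (CurveSum ℓ) where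
  rep := sumRep ℓ R
  dirac := sumDirac ℓ

end

noncomputable section

namespace StretchedGasket

/-! ### The maps and the attractor -/

/-- The Euclidean plane. -/
abbrev Plane : Type := EuclideanSpace ℝ (Fin 2)

/-- The points `p₁, …, p₆` (indexed from `0`): the vertices of an equilateral triangle of side `1`
and the midpoints of its sides, `p₄, p₅, p₆` being opposite to `p₁, p₂, p₃`. -/
def pt : Fin 6 → Plane :=
  ![!₂[0, 0], !₂[1 / 2, √3 / 2], !₂[1, 0],
    (1 / 2 : ℝ) • (!₂[1 / 2, √3 / 2] + !₂[1, 0]),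
    (1 / 2 : ℝ) • (!₂[0, 0] + !₂[1, 0]),
    (1 / 2 : ℝ) • (!₂[0, 0] + !₂[1 / 2, √3 / 2])]

/-- The linear parts `A₁, …, A₆` (indexed from `0`). -/
def mat (α : ℝ) : Fin 6 → Matrix (Fin 2) (Fin 2) ℝ :=
  ![((1 - α) / 2) • !![1, 0; 0, 1],
    ((1 - α) / 2) • !![1, 0; 0, 1],
    ((1 - α) / 2) • !![1, 0; 0, 1],
    (α / 4) • !![1, -√3; -√3, 3],
    α • !![1, 0; 0, 0],
    (α / 4) • !![1, √3; √3, 3]]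

/-- The affine maps `F_j(x) = A_j (x - p_j) + p_j`. -/
def F (α : ℝ) (j : Fin 6) (x : Plane) : Plane :=
  WithLp.toLp 2 (mat α j *ᵥ (x - pt j).ofLp) + pt j

/-- A common Lipschitz constant of the six maps. -/
def ratio (α : ℝ) : ℝ≥0 := Real.toNNReal (max ((1 - α) / 2) α)

theorem ratio_lt_one {α : ℝ} (hα : α ∈ Set.Ioo (0 : ℝ) (1 / 3)) : ratio α < 1 := by
  obtain ⟨h0, h1⟩ := hα
  rw [ratio, Real.toNNReal_lt_one, max_lt_iff]
  constructor <;> linarith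

theorem norm_mat_mulVec_le {α : ℝ} (hα : α ∈ Set.Ioo (0 : ℝ) (1 / 3)) (j : Fin 6) (v : Plane) :
    ‖(WithLp.toLp 2 (mat α j *ᵥ v.ofLp) : Plane)‖ ≤ ratio α * ‖v‖ := by
  obtain ⟨h0, h1⟩ := hα
  have hr : (ratio α : ℝ) = max ((1 - α) / 2) α :=
    Real.coe_toNNReal _ (le_max_of_le_right h0.le)
  have hr1 : (1 - α) / 2 ≤ (ratio α : ℝ) := hr ▸ le_max_left _ _
  have hr2 : α ≤ (ratio α : ℝ) := hr ▸ le_max_right _ _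
  have key : ∀ c : ℝ, 0 ≤ c → c ≤ ratio α → ∀ a b : ℝ,
      a ^ 2 + b ^ 2 ≤ c ^ 2 * (v 0 ^ 2 + v 1 ^ 2) → √(a ^ 2 + b ^ 2) ≤ ratio α * ‖v‖ := by
    intro c hc hcr a b hab
    have hv : ‖v‖ = √(v 0 ^ 2 + v 1 ^ 2) := by
      rw [EuclideanSpace.norm_eq]; simp [Fin.sum_univ_two]
    calc √(a ^ 2 + b ^ 2) ≤ √(c ^ 2 * (v 0 ^ 2 + v 1 ^ 2)) := Real.sqrt_le_sqrt hab
      _ = c * ‖v‖ := by rw [Real.sqrt_mul (sq_nonneg c), Real.sqrt_sq hc, hv]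
      _ ≤ _ := mul_le_mul_of_nonneg_right hcr (norm_nonneg v)
  have h3 : √3 ^ 2 = (3 : ℝ) := Real.sq_sqrt (by norm_num)
  rw [EuclideanSpace.norm_eq]
  simp only [Fin.sum_univ_two, Real.norm_eq_abs, sq_abs]
  have hsim := key ((1 - α) / 2) (by linarith) hr1
  have hjoin := key α h0.le hr2
  fin_cases j <;>
    simp only [mat, Matrix.mulVec, dotProduct, Fin.sum_univ_two] <;> simp
  · exact hsim _ _ (le_of_eq (by ring))
  · exact hsim _ _ (le_of_eq (by ring))
  · exact hsim _ _ (le_of_eq (by ring))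
  · refine hjoin _ _ (le_trans (le_of_eq (b := α ^ 2 / 4 * (v 0 - √3 * v 1) ^ 2) ?_) ?_)
    · linear_combination (α ^ 2 / 16 * (v 0 ^ 2 - 3 * v 1 ^ 2)) * h3
    have h4 : (v 0 - √3 * v 1) ^ 2 + (√3 * v 0 + v 1) ^ 2 = 4 * (v 0 ^ 2 + v 1 ^ 2) := by
      linear_combination (v 0 ^ 2 + v 1 ^ 2) * h3
    nlinarith [mul_nonneg (sq_nonneg α) (sq_nonneg (√3 * v 0 + v 1))]
  · have := hjoin (α * v 0) 0 (by nlinarith [sq_nonneg (α * v 1)])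
    simpa using this
  · refine hjoin _ _ (le_trans (le_of_eq (b := α ^ 2 / 4 * (v 0 + √3 * v 1) ^ 2) ?_) ?_)
    · linear_combination (α ^ 2 / 16 * (v 0 ^ 2 - 3 * v 1 ^ 2)) * h3
    have h4 : (v 0 + √3 * v 1) ^ 2 + (√3 * v 0 - v 1) ^ 2 = 4 * (v 0 ^ 2 + v 1 ^ 2) := by
      linear_combination (v 0 ^ 2 + v 1 ^ 2) * h3
    nlinarith [mul_nonneg (sq_nonneg α) (sq_nonneg (√3 * v 0 - v 1))]

theorem lipschitzWith_F {α : ℝ} (hα : α ∈ Set.Ioo (0 : ℝ) (1 / 3)) (j : Fin 6) :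
    LipschitzWith (ratio α) (F α j) := by
  refine LipschitzWith.of_dist_le_mul fun x y => ?_
  rw [dist_eq_norm, dist_eq_norm]
  have : F α j x - F α j y = WithLp.toLp 2 (mat α j *ᵥ (x - y).ofLp) := by
    simp only [F, add_sub_add_right_eq_sub, ← WithLp.toLp_sub, ← Matrix.mulVec_sub,
      ← WithLp.ofLp_sub, sub_sub_sub_cancel_right]
  rw [this]
  exact norm_mat_mulVec_le hα j _

/-- The union of the images of a non-empty compact set under the six maps. -/
def hutchinson {α : ℝ} (hα : α ∈ Set.Ioo (0 : ℝ) (1 / 3))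
    (K : TopologicalSpace.NonemptyCompacts Plane) : TopologicalSpace.NonemptyCompacts Plane where
  carrier := ⋃ j, F α j '' K
  isCompact' := isCompact_iUnion fun j => K.isCompact.image (lipschitzWith_F hα j).continuous
  nonempty' := Set.nonempty_iUnion.2 ⟨0, K.nonempty.image _⟩

theorem contracting_hutchinson {α : ℝ} (hα : α ∈ Set.Ioo (0 : ℝ) (1 / 3)) :
    ContractingWith (ratio α) (hutchinson hα) := by
  refine ⟨ratio_lt_one hα, fun K L => ?_⟩
  have key : ∀ K L : TopologicalSpace.NonemptyCompacts Plane, ∀ x ∈ (hutchinson hα K : Set Plane),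
      Metric.infEDist x (hutchinson hα L : Set Plane) ≤
        ratio α * Metric.hausdorffEDist (K : Set Plane) L := by
    intro K L x hx
    obtain ⟨j, a, ha, rfl⟩ := Set.mem_iUnion.1 hx
    obtain ⟨b, hb, hab⟩ := L.isCompact.exists_infEDist_eq_edist L.nonempty a
    calc Metric.infEDist (F α j a) (hutchinson hα L : Set Plane)
        ≤ edist (F α j a) (F α j b) :=
          Metric.infEDist_le_edist_of_mem (Set.mem_iUnion.2 ⟨j, b, hb, rfl⟩)
      _ ≤ ratio α * edist a b := lipschitzWith_F hα j a b
      _ ≤ _ := by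
        rw [← hab]
        gcongr
        exact Metric.infEDist_le_hausdorffEDist_of_mem ha
  refine Metric.hausdorffEDist_le_of_infEDist (key K L) fun x hx => ?_
  have := key L K x hx
  rwa [Metric.hausdorffEDist_comm] at this

/-- The stretched Sierpinski gasket `K_α`. -/
def gasket {α : ℝ} (hα : α ∈ Set.Ioo (0 : ℝ) (1 / 3)) : Set Plane :=
  haveI : Nonempty (TopologicalSpace.NonemptyCompacts Plane) := ⟨{0}⟩
  (ContractingWith.fixedPoint (hutchinson hα) (contracting_hutchinson hα) :
    TopologicalSpace.NonemptyCompacts Plane)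

/-- `K_α` is non-empty, compact and the union of its images under the six maps. -/
theorem gasket_spec {α : ℝ} (hα : α ∈ Set.Ioo (0 : ℝ) (1 / 3)) :
    (gasket hα).Nonempty ∧ IsCompact (gasket hα) ∧ gasket hα = ⋃ j, F α j '' gasket hα := by
  have : Nonempty (TopologicalSpace.NonemptyCompacts Plane) := ⟨{0}⟩
  refine ⟨TopologicalSpace.NonemptyCompacts.nonempty _,
    TopologicalSpace.NonemptyCompacts.isCompact _, ?_⟩
  exact congrArg (fun K : TopologicalSpace.NonemptyCompacts Plane => (K : Set Plane))
    (ContractingWith.fixedPoint_isFixedPt (contracting_hutchinson hα)).symm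

/-- `K_α` is the only such set. -/
theorem gasket_unique {α : ℝ} (hα : α ∈ Set.Ioo (0 : ℝ) (1 / 3)) {K : Set Plane}
    (hne : K.Nonempty) (hK : IsCompact K) (h : K = ⋃ j, F α j '' K) : K = gasket hα := by
  have : Nonempty (TopologicalSpace.NonemptyCompacts Plane) := ⟨{0}⟩
  have : Function.IsFixedPt (hutchinson hα) ⟨⟨K, hK⟩, hne⟩ :=
    TopologicalSpace.NonemptyCompacts.ext h.symm
  exact congrArg (fun K : TopologicalSpace.NonemptyCompacts Plane => (K : Set Plane))
    ((contracting_hutchinson hα).fixedPoint_unique this)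

theorem F_mem_gasket {α : ℝ} (hα : α ∈ Set.Ioo (0 : ℝ) (1 / 3)) (j : Fin 6) {x : Plane}
    (hx : x ∈ gasket hα) : F α j x ∈ gasket hα := by
  rw [(gasket_spec hα).2.2]
  exact Set.mem_iUnion.2 ⟨j, x, hx, rfl⟩

instance instCompactSpaceGasket {α : ℝ} (hα : α ∈ Set.Ioo (0 : ℝ) (1 / 3)) :
    CompactSpace (gasket hα) :=
  isCompact_iff_compactSpace.1 (gasket_spec hα).2.1

/-- A compact set covered by its images under the maps lies in `K_α`. -/
theorem subset_gasket {α : ℝ} (hα : α ∈ Set.Ioo (0 : ℝ) (1 / 3)) {M : Set Plane}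
    (hM : IsCompact M) (h : M ⊆ ⋃ j, F α j '' M) : M ⊆ gasket hα := by
  obtain ⟨hne, hK, -⟩ := gasket_spec hα
  rcases M.eq_empty_or_nonempty with rfl | hMne
  · exact Set.empty_subset _
  obtain ⟨x₀, hx₀, hmax⟩ := hM.exists_isMaxOn hMne
    (Metric.continuous_infDist_pt (gasket hα)).continuousOn
  have hz : Metric.infDist x₀ (gasket hα) = 0 := by
    obtain ⟨j, y, hy, hxy⟩ := Set.mem_iUnion.1 (h hx₀)
    obtain ⟨b, hb, hyb⟩ := hK.exists_infDist_eq_dist hne y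
    have h1 : Metric.infDist x₀ (gasket hα) ≤ ratio α * Metric.infDist y (gasket hα) := by
      rw [hyb, ← hxy]
      exact (Metric.infDist_le_dist_of_mem (F_mem_gasket hα j hb)).trans
        ((lipschitzWith_F hα j).dist_le_mul y b)
    have h2 : Metric.infDist y (gasket hα) ≤ Metric.infDist x₀ (gasket hα) := hmax hy
    have h3 : (ratio α : ℝ) < 1 := ratio_lt_one hα
    have h4 : (0 : ℝ) ≤ ratio α := (ratio α).2
    nlinarith [Metric.infDist_nonneg (x := x₀) (s := gasket hα)]
  intro x hx
  rw [hK.isClosed.mem_iff_infDist_zero hne]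
  exact le_antisymm ((hmax hx).trans hz.le) Metric.infDist_nonneg

/-! ### The edges -/

/-- The vertices `p₁, p₂, p₃`. -/
def vtx (i : Fin 3) : Plane := pt (Fin.castAdd 3 i)

/-- `F_w = F_{w_n} ∘ ⋯ ∘ F_{w_1}` for a word `w = w_1 ⋯ w_n` over `{1, 2, 3}`. -/
def wordMap (α : ℝ) : List (Fin 3) → Plane → Plane
  | [] => id
  | j :: w => wordMap α w ∘ F α (Fin.castAdd 3 j)

/-- The edges of the graph approximations of `K_α`. Different indices give different segments:
for each word `w` there are the three sides of the triangle `F_w(T)`, indexed by the opposite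
vertex, and the images under `F_w` of the three initial joining edges. -/
inductive Edge : Type
  | tri (w : List (Fin 3)) (i : Fin 3)
  | join (w : List (Fin 3)) (i : Fin 3)

/-- The initial point `ε⁻` of an edge. -/
def Edge.src (α : ℝ) : Edge → Plane
  | .tri w i => wordMap α w (vtx (i + 1))
  | .join w i => wordMap α w (F α (Fin.natAdd 3 i) (vtx (i + 1)))

/-- The final point `ε⁺` of an edge. -/
def Edge.tgt (α : ℝ) : Edge → Plane
  | .tri w i => wordMap α w (vtx (i + 2))
  | .join w i => wordMap α w (F α (Fin.natAdd 3 i) (vtx (i + 2)))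

/-- The length `L(ε)` of an edge. -/
def Edge.len (α : ℝ) (e : Edge) : ℝ := dist (e.src α) (e.tgt α)

/-- The arc length parametrization `R_ε(t) = L(ε)⁻¹ (t ε⁺ + (L(ε) - t) ε⁻)`, `0 ≤ t ≤ L(ε)`. -/
def Edge.curve (α : ℝ) (e : Edge) (t : ℝ) : Plane :=
  (1 / e.len α) • (t • e.tgt α + (e.len α - t) • e.src α)

theorem F_combo (α : ℝ) (j : Fin 6) (x y : Plane) {a b : ℝ} (hab : a + b = 1) :
    F α j (a • x + b • y) = a • F α j x + b • F α j y := by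
  have h : a • x + b • y - pt j = a • (x - pt j) + b • (y - pt j) := by
    have : pt j = (a + b) • pt j := by rw [hab, one_smul]
    nth_rewrite 1 [this]
    module
  have h2 : pt j = (a + b) • pt j := by rw [hab, one_smul]
  simp only [F, h, WithLp.ofLp_add, WithLp.ofLp_smul, Matrix.mulVec_add, Matrix.mulVec_smul,
    WithLp.toLp_add, WithLp.toLp_smul]
  nth_rewrite 3 [h2]
  module

theorem F_vtx_left (α : ℝ) (i : Fin 3) :
    F α (Fin.castAdd 3 (i + 1)) (vtx (i + 1)) = vtx (i + 1) ∧
    F α (Fin.castAdd 3 (i + 1)) (vtx (i + 2)) =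
      (1 - (1 - α) / 2) • vtx (i + 1) + ((1 - α) / 2) • vtx (i + 2) := by
  constructor
  · simp [F, vtx]
  · fin_cases i <;> ext k <;> fin_cases k <;>
      simp [F, vtx, pt, mat] <;> ring

theorem F_vtx_right (α : ℝ) (i : Fin 3) :
    F α (Fin.castAdd 3 (i + 2)) (vtx (i + 1)) =
      ((1 - α) / 2) • vtx (i + 1) + (1 - (1 - α) / 2) • vtx (i + 2) ∧
    F α (Fin.castAdd 3 (i + 2)) (vtx (i + 2)) = vtx (i + 2) := by
  constructor
  · fin_cases i <;> ext k <;> fin_cases k <;>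
      simp [F, vtx, pt, mat] <;> ring
  · simp [F, vtx]

theorem F_vtx_mid (α : ℝ) (i : Fin 3) :
    F α (Fin.natAdd 3 i) (vtx (i + 1)) =
      (1 - (1 - α) / 2) • vtx (i + 1) + ((1 - α) / 2) • vtx (i + 2) ∧
    F α (Fin.natAdd 3 i) (vtx (i + 2)) =
      ((1 - α) / 2) • vtx (i + 1) + (1 - (1 - α) / 2) • vtx (i + 2) := by
  have h3 : √3 ^ 2 = (3 : ℝ) := Real.sq_sqrt (by norm_num)
  constructor <;> fin_cases i <;> ext k <;> fin_cases k <;>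
      simp [F, vtx, pt, mat] <;> ring_nf <;>
      (try rw [h3]) <;> ring_nf

theorem side_subset_gasket {α : ℝ} (hα : α ∈ Set.Ioo (0 : ℝ) (1 / 3)) (i : Fin 3) :
    segment ℝ (vtx (i + 1)) (vtx (i + 2)) ⊆ gasket hα := by
  obtain ⟨h0, h1⟩ := id hα
  have hcomp : IsCompact (segment ℝ (vtx (i + 1)) (vtx (i + 2))) := by
    rw [segment_eq_image_lineMap]
    exact isCompact_Icc.image AffineMap.lineMap_continuous
  refine subset_gasket hα hcomp ?_
  rintro _ ⟨a, b, ha, hb, hab, rfl⟩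
  obtain rfl : a = 1 - b := by linarith
  set c := (1 - α) / 2 with hc
  have hcpos : 0 < c := by rw [hc]; linarith
  refine Set.mem_iUnion.2 ?_
  rcases le_or_gt b c with h | h
  · refine ⟨Fin.castAdd 3 (i + 1), (1 - b / c) • vtx (i + 1) + (b / c) • vtx (i + 2),
      ⟨_, _, ?_, by positivity, by ring, rfl⟩, ?_⟩
    · rw [sub_nonneg, div_le_one hcpos]; exact h
    · rw [F_combo _ _ _ _ (by ring), (F_vtx_left α i).1, (F_vtx_left α i).2, ← hc]
      have : b = (b / c) * c := by field_simp
      rw [smul_add, smul_smul, smul_smul, ← add_assoc, ← add_smul, ← this]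
      congr 2
      linear_combination this
  rcases le_or_gt (1 - c) b with h' | h'
  · refine ⟨Fin.castAdd 3 (i + 2), ((1 - b) / c) • vtx (i + 1) + (1 - (1 - b) / c) • vtx (i + 2),
      ⟨_, _, by positivity, ?_, by ring, rfl⟩, ?_⟩
    · rw [sub_nonneg, div_le_one hcpos]; linarith
    · rw [F_combo _ _ _ _ (by ring), (F_vtx_right α i).1, (F_vtx_right α i).2, ← hc]
      have : 1 - b = ((1 - b) / c) * c := by field_simp
      rw [smul_add, smul_smul, smul_smul, add_assoc, ← add_smul, ← this]
      congr 2
      linear_combination this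
  · refine ⟨Fin.natAdd 3 i, (1 - (b - c) / α) • vtx (i + 1) + ((b - c) / α) • vtx (i + 2),
      ⟨_, _, ?_, div_nonneg (by linarith) h0.le, by ring, rfl⟩, ?_⟩
    · rw [sub_nonneg, div_le_one h0, hc] at *; linarith
    · rw [F_combo _ _ _ _ (by ring), (F_vtx_mid α i).1, (F_vtx_mid α i).2, ← hc]
      have h5 : ((b - c) / α) * α = b - c := by field_simp
      have h6 : α = 1 - 2 * c := by rw [hc]; ring
      have h7 : ((b - c) / α) * (1 - 2 * c) = b - c := by rw [← h6]; exact h5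
      generalize (b - c) / α = s at h7
      have hb' : b = c + s * (1 - 2 * c) := by linarith
      rw [hb']
      module

theorem wordMap_combo (α : ℝ) (w : List (Fin 3)) (x y : Plane) {a b : ℝ} (hab : a + b = 1) :
    wordMap α w (a • x + b • y) = a • wordMap α w x + b • wordMap α w y := by
  induction w generalizing x y with
  | nil => rfl
  | cons j w ih => simp only [wordMap, Function.comp_apply, F_combo _ _ _ _ hab, ih]

theorem wordMap_mem_gasket {α : ℝ} (hα : α ∈ Set.Ioo (0 : ℝ) (1 / 3)) (w : List (Fin 3))
    {x : Plane} (hx : x ∈ gasket hα) : wordMap α w x ∈ gasket hα := by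
  induction w generalizing x with
  | nil => exact hx
  | cons j w ih => exact ih (F_mem_gasket hα _ hx)

theorem Edge.segment_subset_gasket {α : ℝ} (hα : α ∈ Set.Ioo (0 : ℝ) (1 / 3)) (e : Edge) :
    segment ℝ (e.src α) (e.tgt α) ⊆ gasket hα := by
  rintro _ ⟨a, b, ha, hb, hab, rfl⟩
  cases e with
  | tri w i =>
    simp only [Edge.src, Edge.tgt, ← wordMap_combo _ _ _ _ hab]
    exact wordMap_mem_gasket hα w (side_subset_gasket hα i ⟨a, b, ha, hb, hab, rfl⟩)
  | join w i =>
    simp only [Edge.src, Edge.tgt, ← wordMap_combo _ _ _ _ hab, ← F_combo _ _ _ _ hab]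
    exact wordMap_mem_gasket hα w
      (F_mem_gasket hα _ (side_subset_gasket hα i ⟨a, b, ha, hb, hab, rfl⟩))

theorem Edge.curve_mem_gasket {α : ℝ} (hα : α ∈ Set.Ioo (0 : ℝ) (1 / 3)) (e : Edge) {t : ℝ}
    (ht : t ∈ Set.Icc 0 (e.len α)) (hpos : 0 < e.len α) : e.curve α t ∈ gasket hα := by
  refine e.segment_subset_gasket hα ⟨(e.len α - t) / e.len α, t / e.len α,
    div_nonneg (by linarith [ht.2]) hpos.le, div_nonneg ht.1 hpos.le, by field_simp; ring, ?_⟩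
  rw [Edge.curve, smul_add, smul_smul, smul_smul, add_comm, div_mul_eq_mul_div, one_mul,
    div_mul_eq_mul_div, one_mul]

theorem F_castAdd_sub (α : ℝ) (j : Fin 3) (x y : Plane) :
    F α (Fin.castAdd 3 j) x - F α (Fin.castAdd 3 j) y = ((1 - α) / 2) • (x - y) := by
  fin_cases j <;> ext k <;> fin_cases k <;> simp [F, mat, Matrix.vecHead, Matrix.vecTail] <;> ring

theorem wordMap_sub (α : ℝ) (w : List (Fin 3)) (x y : Plane) :
    wordMap α w x - wordMap α w y = ((1 - α) / 2) ^ w.length • (x - y) := by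
  induction w generalizing x y with
  | nil => simp [wordMap]
  | cons j w ih =>
    simp only [wordMap, Function.comp_apply, ih, F_castAdd_sub, smul_smul, List.length_cons,
      pow_succ]

theorem norm_vtx_sub (i : Fin 3) : ‖vtx (i + 1) - vtx (i + 2)‖ = 1 := by
  have h3 : √3 ^ 2 = (3 : ℝ) := Real.sq_sqrt (by norm_num)
  rw [EuclideanSpace.norm_eq, Real.sqrt_eq_one]
  fin_cases i <;> simp [Fin.sum_univ_two, vtx, pt, div_pow] <;> norm_num

/-- The sides of the triangles of level `n` have length `((1 - α) / 2) ^ n`. -/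
theorem Edge.len_tri {α : ℝ} (hα : α ∈ Set.Ioo (0 : ℝ) (1 / 3)) (w : List (Fin 3)) (i : Fin 3) :
    (Edge.tri w i).len α = ((1 - α) / 2) ^ w.length := by
  obtain ⟨h0, h1⟩ := hα
  simp only [Edge.len, Edge.src, Edge.tgt, dist_eq_norm, wordMap_sub, norm_smul, norm_vtx_sub,
    norm_pow, mul_one]
  rw [Real.norm_of_nonneg (by linarith)]

/-- The joining edges have length `α ((1 - α) / 2) ^ n`. -/
theorem Edge.len_join {α : ℝ} (hα : α ∈ Set.Ioo (0 : ℝ) (1 / 3)) (w : List (Fin 3)) (i : Fin 3) :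
    (Edge.join w i).len α = α * ((1 - α) / 2) ^ w.length := by
  obtain ⟨h0, h1⟩ := hα
  have h : F α (Fin.natAdd 3 i) (vtx (i + 1)) - F α (Fin.natAdd 3 i) (vtx (i + 2)) =
      α • (vtx (i + 1) - vtx (i + 2)) := by
    rw [(F_vtx_mid α i).1, (F_vtx_mid α i).2]
    module
  simp only [Edge.len, Edge.src, Edge.tgt, dist_eq_norm, wordMap_sub, norm_smul, norm_vtx_sub,
    norm_pow, mul_one, h]
  rw [Real.norm_of_nonneg (by linarith), Real.norm_of_nonneg (by linarith), mul_comm]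

theorem Edge.len_pos {α : ℝ} (hα : α ∈ Set.Ioo (0 : ℝ) (1 / 3)) (e : Edge) : 0 < e.len α := by
  have h : 0 < (1 - α) / 2 := by linarith [hα.2]
  cases e with
  | tri w i => rw [Edge.len_tri hα]; positivity
  | join w i => rw [Edge.len_join hα]; exact mul_pos hα.1 (pow_pos h _)

/-- The curve `R_ε` as a continuous map into `K_α`; it is extended to all of `ℝ` by its end values,
only its values on `[0, L(ε)]` matter. -/
def Edge.curveMap {α : ℝ} (hα : α ∈ Set.Ioo (0 : ℝ) (1 / 3)) (e : Edge) : C(ℝ, gasket hα) where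
  toFun t := ⟨e.curve α (Set.projIcc 0 (e.len α) (e.len_pos hα).le t),
    e.curve_mem_gasket hα (Set.projIcc 0 (e.len α) (e.len_pos hα).le t).2 (e.len_pos hα)⟩
  continuous_toFun := by
    have := continuous_projIcc (a := 0) (b := e.len α) (h := (e.len_pos hα).le)
    unfold Edge.curve
    fun_prop

/-- The spectral triple `S(K_α)`: the direct sum of the spectral triples of all the edges. -/
def spectralTriple {α : ℝ} (hα : α ∈ Set.Ioo (0 : ℝ) (1 / 3)) :
    SpectralTripleData C(gasket hα, ℂ) (CurveSum (Edge.len α)) :=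
  curveTriple (Edge.len α) (fun e => e.curveMap hα)

end StretchedGasket

end

/-! Write $c=(1-\alpha)/2$; then $d_\alpha$ is the exponent with $3c^{d_\alpha}=1$, and $\alpha<1/3$
makes $c>1/3$, hence $d_\alpha>1$ (`one_lt_gasketDim`).

Spectral dimension. The functions $\varphi_k$ on an edge of length $\ell$ form an orthonormal basis
of eigenvectors of $D_\varepsilon$ with eigenvalues $\pi(2k+1)/(2\ell)$. So $D_\alpha$ is diagonal
on its maximal domain (`exists_isDiagonal_sumDirac`), and the trace is a double sum over edges and
integers (`IsDiagonal.posTrace_rpow`). Up to constants it behaves like $\sum_\varepsilon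
\ell_\varepsilon^p\cdot\sum_k|2k+1|^{-p}$. Each word of length $n$ contributes three edges of length
$c^n$ and three of length $\alpha c^n$, so the edge sum is comparable to $\sum_n(3c^p)^n$. It is
finite exactly for $p>d_\alpha$, and there $p>1$, so the sum over $k$ also converges
(`tsum_eigenvalues_lt_top_iff`).

Hausdorff dimension. From below, $K_\alpha$ contains the self-similar set of the three similarities,
whose pieces are separated because $2c<1$. Reading addresses as ternary expansions maps it onto
$[0,1]$, Hölder continuously with exponent $d_\alpha$ (`holderOnWith_ofDigits_code`). From above, a
point of $K_\alpha$ either lies in triangle pieces of all levels or in one of countably many pieces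
of lines (`gasket_subset`). The former set has finite $d_\alpha$-dimensional measure
(`hausdorffMeasure_cantorPart_le`); the latter have dimension at most $1<d_\alpha$. -/

noncomputable section

/-! ### Traces of positive operators -/

section Trace

variable {H : Type*} [NormedAddCommGroup H] [InnerProductSpace ℂ H]

theorem HilbertBasis.tsum_ofReal_norm_inner_sq {ι : Type*} (b : HilbertBasis ι ℂ H) (x : H) :
    ∑' i, ENNReal.ofReal (‖⟪b i, x⟫_ℂ‖ ^ 2) = ENNReal.ofReal (‖x‖ ^ 2) := by
  have h := lp.hasSum_norm (p := 2) (by norm_num) (b.repr x)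
  simp only [ENNReal.toReal_ofNat, Real.rpow_ofNat, b.repr_apply_apply,
    LinearIsometryEquiv.norm_map] at h
  rw [← h.tsum_eq, ENNReal.ofReal_tsum_of_nonneg (fun _ => by positivity) h.summable]

variable [CompleteSpace H]

/-- Parseval turns both sides into the same double sum of $|\langle c_j,Sb_i\rangle|^2$, by
self-adjointness. Applied to $S=\sqrt T$, this gives the basis independence of the trace. -/
theorem HilbertBasis.tsum_norm_sq_eq {ι κ : Type*} (b : HilbertBasis ι ℂ H)
    (c : HilbertBasis κ ℂ H) {S : H →L[ℂ] H} (hS : IsSelfAdjoint S) :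
    ∑' i, ENNReal.ofReal (‖S (b i)‖ ^ 2) = ∑' j, ENNReal.ofReal (‖S (c j)‖ ^ 2) := by
  simp_rw [← c.tsum_ofReal_norm_inner_sq (S (b _)), ← b.tsum_ofReal_norm_inner_sq (S (c _))]
  rw [ENNReal.tsum_comm]
  refine tsum_congr fun j => tsum_congr fun i => ?_
  have : ⟪S (c j), b i⟫_ℂ = ⟪c j, S (b i)⟫_ℂ := hS.isSymmetric _ _
  rw [← this, norm_inner_symm]

/-- The trace of a positive operator can be computed in any Hilbert basis. -/
theorem posTrace_eq_tsum {ι : Type*} (b : HilbertBasis ι ℂ H) {T : H →L[ℂ] H} (hT : 0 ≤ T) :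
    posTrace T = ∑' i, ENNReal.ofReal (RCLike.re ⟪b i, T (b i)⟫_ℂ) := by
  have hS : IsSelfAdjoint (CFC.sqrt T) := .of_nonneg (CFC.sqrt_nonneg T)
  have key : ∀ x, RCLike.re ⟪x, T x⟫_ℂ = ‖CFC.sqrt T x‖ ^ 2 := by
    intro x
    have h1 : T x = CFC.sqrt T (CFC.sqrt T x) := by
      conv_lhs => rw [← CFC.sqrt_mul_sqrt_self T hT]
      rfl
    have h2 : ⟪CFC.sqrt T x, CFC.sqrt T x⟫_ℂ = ⟪x, CFC.sqrt T (CFC.sqrt T x)⟫_ℂ :=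
      hS.isSymmetric _ _
    rw [h1, ← h2, inner_self_eq_norm_sq]
  simp only [posTrace, key]
  exact HilbertBasis.tsum_norm_sq_eq _ b hS

/-- Eigenvectors of `T` are eigenvectors of the continuous functions of `T`. -/
theorem cfc_apply_of_eigenvector {T : H →L[ℂ] H} (hT : IsSelfAdjoint T) {v : H} (hv : v ≠ 0)
    {μ : ℝ} (h : T v = (μ : ℂ) • v) {f : ℝ → ℝ} (hf : ContinuousOn f (spectrum ℝ T)) :
    cfc f T v = (f μ : ℂ) • v := by
  -- Functions on the spectrum can be evaluated at $\mu$ only once $\mu$ is known to lie there.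
  have hμ : μ ∈ spectrum ℝ T := by
    rw [spectrum.mem_iff]
    rintro ⟨u, hu⟩
    apply hv
    have h1 : (u : H →L[ℂ] H) v = 0 := by
      rw [hu, Algebra.algebraMap_eq_smul_one]
      simp [h]
    calc v = ((↑u⁻¹ : H →L[ℂ] H) * u) v := by simp
      _ = 0 := by rw [mul_apply_eq_comp, h1, map_zero]
  rw [cfc_apply f T hT hf]
  -- The functions $g$ with this property form a closed subalgebra containing the constants and the
  -- identity, so Stone–Weierstrass applies.
  suffices ∀ g : C(spectrum ℝ T, ℝ), cfcHom hT g v = ((g ⟨μ, hμ⟩ : ℝ) : ℂ) • v from this _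
  intro g
  induction g using ContinuousMap.induction_on_of_compact with
  | const r =>
    have : cfcHom hT (ContinuousMap.const _ r) = algebraMap ℝ (H →L[ℂ] H) r :=
      AlgHomClass.commutes (cfcHom hT) r
    rw [this, Algebra.algebraMap_eq_smul_one]
    simp
  | id =>
    have : cfcHom hT (.restrict (spectrum ℝ T) (.id ℝ)) = T := cfcHom_id hT
    rw [this]
    exact h
  | star_id =>
    have : cfcHom hT (.restrict (spectrum ℝ T) (.id ℝ)) = T := cfcHom_id hT
    rw [map_star, this, hT.star_eq]
    simpa using h
  | add f g hf hg => simp [map_add, hf, hg, add_smul]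
  | mul f g hf hg =>
    rw [map_mul, mul_apply_eq_comp, hg, map_smul, hf, smul_smul, ContinuousMap.mul_apply,
      Complex.ofReal_mul, mul_comm]
  | frequently f hf =>
    have hc : IsClosed {g : C(spectrum ℝ T, ℝ) | cfcHom hT g v = ((g ⟨μ, hμ⟩ : ℝ) : ℂ) • v} := by
      refine isClosed_eq ?_ ?_
      · exact (ContinuousLinearMap.apply ℂ H v).continuous.comp (cfcHom_continuous hT)
      · exact (Complex.continuous_ofReal.comp (continuous_eval_const _)).smul
          continuous_const
    exact hc.closure_subset (mem_closure_iff_frequently.2 hf)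

end Trace

/-! ### Diagonal operators -/

section Diagonal

variable {H : Type*} [NormedAddCommGroup H] [InnerProductSpace ℂ H] {ι : Type*}

/-- The operator `D` is diagonal in the Hilbert basis `b` with the eigenvalues `lam`, on its maximal
domain. -/
def IsDiagonal (D : H →ₗ.[ℂ] H) (b : HilbertBasis ι ℂ H) (lam : ι → ℝ) : Prop :=
  ∀ x y : H, (x, y) ∈ D.graph ↔ ∀ i, b.repr y i = (lam i : ℂ) * b.repr x i

theorem memℓp_mul_of_norm_le_one {c : ι → ℂ} (hc : ∀ i, ‖c i‖ ≤ 1) (x : lp (fun _ : ι => ℂ) 2) :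
    Memℓp (fun i => c i * x i) 2 := by
  refine (lp.memℓp x).mono' fun i => ?_
  rw [norm_mul]
  exact mul_le_of_le_one_left (norm_nonneg _) (hc i)

/-- The bounded operator which is diagonal in a Hilbert basis with eigenvalues in the unit disc. -/
def HilbertBasis.diagonal (b : HilbertBasis ι ℂ H) (c : ι → ℂ) (hc : ∀ i, ‖c i‖ ≤ 1) :
    H →L[ℂ] H :=
  LinearMap.mkContinuous
    { toFun := fun x => b.repr.symm ⟨fun i => c i * b.repr x i, memℓp_mul_of_norm_le_one hc _⟩
      map_add' := fun x y => by
        rw [← map_add]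
        congr 1
        ext i
        simp only [map_add, lp.coeFn_add, Pi.add_apply, mul_add]
      map_smul' := fun a x => by
        rw [RingHom.id_apply, ← map_smul]
        congr 1
        ext i
        simp [mul_left_comm] }
    1 (fun x => by
      rw [one_mul]
      change ‖b.repr.symm _‖ ≤ _
      rw [LinearIsometryEquiv.norm_map, ← b.repr.norm_map x]
      refine lp.norm_mono (by norm_num) fun i => ?_
      change ‖c i * b.repr x i‖ ≤ _
      rw [norm_mul]
      exact mul_le_of_le_one_left (norm_nonneg _) (hc i))

theorem HilbertBasis.repr_diagonal (b : HilbertBasis ι ℂ H) {c : ι → ℂ} (hc : ∀ i, ‖c i‖ ≤ 1)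
    (x : H) (i : ι) : b.repr (b.diagonal c hc x) i = c i * b.repr x i := by
  change b.repr (b.repr.symm _) i = _
  rw [LinearIsometryEquiv.apply_symm_apply]

theorem HilbertBasis.ext_repr (b : HilbertBasis ι ℂ H) {x y : H}
    (h : ∀ i, b.repr x i = b.repr y i) : x = y :=
  b.repr.injective (lp.ext (funext h))

theorem HilbertBasis.diagonal_apply_self (b : HilbertBasis ι ℂ H) {c : ι → ℂ}
    (hc : ∀ i, ‖c i‖ ≤ 1) (i : ι) : b.diagonal c hc (b i) = c i • b i := by
  classical
  refine b.ext_repr fun j => ?_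
  rw [b.repr_diagonal, map_smul, b.repr_self]
  rcases eq_or_ne j i with rfl | h
  · simp
  · simp [lp.single_apply, Pi.single_eq_of_ne h]

theorem norm_inv_one_add_sq_le (t : ℝ) : ‖(((1 + t ^ 2)⁻¹ : ℝ) : ℂ)‖ ≤ 1 := by
  rw [Complex.norm_real, Real.norm_of_nonneg (by positivity)]
  exact inv_le_one_of_one_le₀ (by nlinarith [sq_nonneg t])

theorem norm_mul_inv_one_add_sq_le (t : ℝ) : ‖((t * (1 + t ^ 2)⁻¹ : ℝ) : ℂ)‖ ≤ 1 := by
  rw [Complex.norm_real, Real.norm_eq_abs, abs_mul, abs_of_nonneg (a := (1 + t ^ 2)⁻¹)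
    (by positivity), ← div_eq_mul_inv, div_le_one (by positivity)]
  nlinarith [sq_abs t, sq_nonneg (|t| - 1)]

/-- `(I + D²)⁻¹` for a diagonal operator `D`. -/
theorem IsDiagonal.isInvOneAddSq {D : H →ₗ.[ℂ] H} {b : HilbertBasis ι ℂ H} {lam : ι → ℝ}
    (hD : IsDiagonal D b lam) :
    IsInvOneAddSq D (b.diagonal _ fun i => norm_inv_one_add_sq_le (lam i)) := by
  have hne : ∀ i, (1 + (lam i : ℂ) ^ 2) ≠ 0 := fun i => by
    have : (1 + lam i ^ 2) ≠ 0 := by positivity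
    exact_mod_cast this
  intro x z
  constructor
  · rintro rfl
    set x := b.diagonal _ (fun i => norm_inv_one_add_sq_le (lam i)) z with hx
    -- The candidate for $Dx$: the multiplier $\lambda/(1+\lambda^2)$ is bounded, and
    -- $\lambda^2/(1+\lambda^2)=1-1/(1+\lambda^2)$ yields $Dy=z-x$.
    set y := b.diagonal _ (fun i => norm_mul_inv_one_add_sq_le (lam i)) z with hy
    have h1 : (x, y) ∈ D.graph := (hD _ _).2 fun i => by
      rw [hx, hy, b.repr_diagonal, b.repr_diagonal]
      push_cast
      ring
    have h2 : (y, z - x) ∈ D.graph := (hD _ _).2 fun i => by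
      rw [map_sub, lp.coeFn_sub, Pi.sub_apply, hx, hy, b.repr_diagonal, b.repr_diagonal]
      push_cast
      have := hne i
      field_simp
      ring
    obtain ⟨⟨x', hx'⟩, rfl, h1'⟩ := (LinearPMap.mem_graph_iff _).1 h1
    obtain ⟨⟨y', hy'⟩, h2'', h2'⟩ := (LinearPMap.mem_graph_iff _).1 h2
    dsimp only at h1' h2' h2''
    refine ⟨hx', ?_, ?_⟩
    · rw [h1', ← h2'']
      exact hy'
    · have : (⟨D ⟨x, hx'⟩, by rw [h1', ← h2'']; exact hy'⟩ : D.domain) = ⟨y', hy'⟩ := by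
        rw [Subtype.mk.injEq, h1', ← h2'']
      rw [this, h2']
      abel
  · rintro ⟨hx, hDx, rfl⟩
    have h1 := (hD _ _).1 (D.mem_graph ⟨x, hx⟩)
    have h2 := (hD _ _).1 (D.mem_graph ⟨_, hDx⟩)
    refine b.ext_repr fun i => ?_
    rw [b.repr_diagonal, map_add, lp.coeFn_add, Pi.add_apply, h2 i]
    dsimp only at h1 ⊢
    rw [h1 i]
    push_cast
    have := hne i
    field_simp

/-- The defining property fixes the graph. Hence any $T$ occurring in the definition of the
dimension is the explicit diagonal operator. -/
theorem IsInvOneAddSq.unique {D : H →ₗ.[ℂ] H} {S T : H →L[ℂ] H} (hS : IsInvOneAddSq D S)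
    (hT : IsInvOneAddSq D T) : S = T :=
  ContinuousLinearMap.ext fun z => ((hT _ z).2 ((hS _ z).1 rfl)).symm

theorem HilbertBasis.diagonal_nonneg [CompleteSpace H] (b : HilbertBasis ι ℂ H) {c : ι → ℝ}
    (h0 : ∀ i, 0 ≤ c i) (hc : ∀ i, ‖(c i : ℂ)‖ ≤ 1) : 0 ≤ b.diagonal _ hc := by
  rw [ContinuousLinearMap.nonneg_iff_isPositive, ContinuousLinearMap.isPositive_def']
  refine ⟨?_, fun x => ?_⟩
  · rw [ContinuousLinearMap.isSelfAdjoint_iff_isSymmetric]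
    intro x y
    change ⟪b.diagonal _ hc x, y⟫_ℂ = ⟪x, b.diagonal _ hc y⟫_ℂ
    rw [← b.repr.inner_map_map, ← b.repr.inner_map_map x, lp.inner_eq_tsum, lp.inner_eq_tsum]
    refine tsum_congr fun i => ?_
    rw [b.repr_diagonal, b.repr_diagonal]
    simp
    ring
  · change 0 ≤ RCLike.re ⟪b.diagonal _ hc x, x⟫_ℂ
    rw [← b.repr.inner_map_map]
    have h := lp.hasSum_inner (𝕜 := ℂ) (b.repr (b.diagonal _ hc x)) (b.repr x)
    refine (h.mapL (RCLike.reCLM (K := ℂ))).nonneg fun i => ?_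
    have : ⟪b.repr (b.diagonal _ hc x) i, b.repr x i⟫_ℂ =
        ((c i * ‖b.repr x i‖ ^ 2 : ℝ) : ℂ) := by
      rw [b.repr_diagonal]
      simp only [RCLike.inner_apply, map_mul, Complex.conj_ofReal]
      push_cast
      rw [← Complex.mul_conj']
      ring
    rw [this]
    exact mul_nonneg (h0 i) (sq_nonneg _)

/-- The trace of `(I + D²) ^ (-p / 2)` for a diagonal operator `D`. -/
theorem IsDiagonal.posTrace_rpow [CompleteSpace H] {D : H →ₗ.[ℂ] H} {b : HilbertBasis ι ℂ H}
    {lam : ι → ℝ} (hD : IsDiagonal D b lam) {T : H →L[ℂ] H} (hT : IsInvOneAddSq D T) {p : ℝ}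
    (hp : 0 < p) :
    posTrace (T ^ (p / 2)) = ∑' i, ENNReal.ofReal ((1 + lam i ^ 2)⁻¹ ^ (p / 2)) := by
  obtain rfl := hT.unique hD.isInvOneAddSq
  set T := b.diagonal _ fun i => norm_inv_one_add_sq_le (lam i) with hTdef
  have hT0 : 0 ≤ T :=
    b.diagonal_nonneg (fun i => inv_nonneg.2 (add_nonneg zero_le_one (sq_nonneg (lam i)))) _
  rw [posTrace_eq_tsum b CFC.rpow_nonneg]
  refine tsum_congr fun i => ?_
  have hbi : ‖b i‖ = 1 := b.orthonormal.1 i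
  have hv : b i ≠ 0 := fun h => by simp [h] at hbi
  have h1 : (T ^ (p / 2)) (b i) = (((1 + lam i ^ 2)⁻¹ ^ (p / 2) : ℝ) : ℂ) • b i := by
    rw [CFC.rpow_eq_cfc_real (ha := hT0)]
    -- The spectrum may contain $0$; $p>0$ keeps the power function continuous there.
    exact cfc_apply_of_eigenvector (f := fun x => x ^ (p / 2)) (.of_nonneg hT0) hv
      (b.diagonal_apply_self _ i)
      (Real.continuous_rpow_const (half_pos hp).le).continuousOn
  rw [h1, inner_smul_right, inner_self_eq_norm_sq_to_K, hbi]
  simp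

/-- The spectral dimension of a triple whose operator is diagonal. -/
theorem SpectralTripleData.dimension_eq_of_isDiagonal [CompleteSpace H] {A : Type*} [Ring A]
    [StarRing A] [Algebra ℂ A] (S : SpectralTripleData A H) {b : HilbertBasis ι ℂ H} {lam : ι → ℝ}
    (hD : IsDiagonal S.dirac b lam) :
    S.dimension = sInf {d | ∃ p : ℝ, 0 < p ∧ d = ENNReal.ofReal p ∧
      ∑' i, ENNReal.ofReal ((1 + lam i ^ 2)⁻¹ ^ (p / 2)) < ∞} := by
  unfold SpectralTripleData.dimension
  congr 1
  ext d
  refine exists_congr fun p => and_congr_right fun hp => and_congr_right fun _ => ?_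
  constructor
  · rintro ⟨T, hT, h⟩
    rwa [hD.posTrace_rpow hT hp] at h
  · intro h
    exact ⟨_, hD.isInvOneAddSq, by rwa [hD.posTrace_rpow hD.isInvOneAddSq hp]⟩

end Diagonal

end

noncomputable section

/-! ### The Fourier basis of a curve -/

section Curve

open MeasureTheory AddCircle

theorem curveMeasure_eq_restrict_Ioc {ℓ : ℝ} : curveMeasure ℓ =
    ENNReal.ofReal (1 / (2 * ℓ)) • volume.restrict (Set.Ioc (-ℓ) (-ℓ + 2 * ℓ)) := by
  rw [curveMeasure, show -ℓ + 2 * ℓ = ℓ by ring, restrict_Ioc_eq_restrict_Icc]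

theorem haarAddCircle_eq_smul_volume {T : ℝ} [hT : Fact (0 < T)] :
    (haarAddCircle : Measure (AddCircle T)) = ENNReal.ofReal (1 / T) • volume := by
  have := hT.out
  rw [volume_eq_smul_haarAddCircle, smul_smul, ← ENNReal.ofReal_mul (by positivity),
    one_div_mul_cancel this.ne', ENNReal.ofReal_one, one_smul]

/-- The weight $1/(2\ell)$ matches the normalized Haar measure, for which the Fourier basis of the
circle is orthonormal; the doubled endpoint is a null set. -/
theorem measurePreserving_mk_curveMeasure (ℓ : ℝ) [Fact (0 < 2 * ℓ)] :
    MeasurePreserving (fun x : ℝ => (x : AddCircle (2 * ℓ))) (curveMeasure ℓ) haarAddCircle := by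
  rw [curveMeasure_eq_restrict_Ioc, haarAddCircle_eq_smul_volume]
  exact (AddCircle.measurePreserving_mk (2 * ℓ) (-ℓ)).smul_measure _

theorem measurePreserving_equivIoc_curveMeasure (ℓ : ℝ) [Fact (0 < 2 * ℓ)] :
    MeasurePreserving (fun x : AddCircle (2 * ℓ) => (equivIoc (2 * ℓ) (-ℓ) x : ℝ))
      haarAddCircle (curveMeasure ℓ) := by
  rw [curveMeasure_eq_restrict_Ioc, haarAddCircle_eq_smul_volume]
  refine MeasurePreserving.smul_measure ?_ _
  exact (measurePreserving_subtype_coe measurableSet_Ioc).comp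
    (measurePreserving_equivIoc (T := 2 * ℓ) (a := -ℓ))

/-- Functions on the circle of length `2ℓ` as functions on `[-ℓ, ℓ]`. -/
def circleToCurve (ℓ : ℝ) [Fact (0 < 2 * ℓ)] :
    Lp ℂ 2 (haarAddCircle (T := 2 * ℓ)) →ₗᵢ[ℂ] CurveSpace ℓ :=
  Lp.compMeasurePreservingₗᵢ ℂ _ (measurePreserving_mk_curveMeasure ℓ)

theorem circleToCurve_coe (ℓ : ℝ) [Fact (0 < 2 * ℓ)] (f : Lp ℂ 2 (haarAddCircle (T := 2 * ℓ))) :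
    circleToCurve ℓ f =ᵐ[curveMeasure ℓ] fun x => f (x : AddCircle (2 * ℓ)) :=
  Lp.coeFn_compMeasurePreserving f (measurePreserving_mk_curveMeasure ℓ)

theorem ae_curveMeasure_mem_Ioc (ℓ : ℝ) :
    ∀ᵐ x ∂curveMeasure ℓ, x ∈ Set.Ioc (-ℓ) (-ℓ + 2 * ℓ) := by
  rw [curveMeasure_eq_restrict_Ioc]
  exact Measure.ae_smul_measure (ae_restrict_mem measurableSet_Ioc) _

theorem circleToCurve_surjective (ℓ : ℝ) [Fact (0 < 2 * ℓ)] :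
    Function.Surjective (circleToCurve ℓ) := by
  intro g
  refine ⟨Lp.compMeasurePreserving _ (measurePreserving_equivIoc_curveMeasure ℓ) g, Lp.ext ?_⟩
  have h1 := (measurePreserving_mk_curveMeasure ℓ).quasiMeasurePreserving.ae
    (Lp.coeFn_compMeasurePreserving g (measurePreserving_equivIoc_curveMeasure ℓ))
  filter_upwards [circleToCurve_coe ℓ _, h1, ae_curveMeasure_mem_Ioc ℓ] with x hx hx1 hx2
  rw [hx, hx1, Function.comp_apply, equivIoc_coe_of_mem hx2]

/-- The Hilbert basis of the functions `φ_k`. -/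
def curveBasis (ℓ : ℝ) (hℓ : 0 < ℓ) : HilbertBasis ℤ ℂ (CurveSpace ℓ) :=
  haveI : Fact (0 < 2 * ℓ) := ⟨by positivity⟩
  .ofRepr ((LinearIsometryEquiv.ofSurjective _ (circleToCurve_surjective ℓ)).symm.trans
    fourierBasis.repr)

theorem curveBasis_coe (ℓ : ℝ) (hℓ : 0 < ℓ) (k : ℤ) :
    curveBasis ℓ hℓ k =ᵐ[curveMeasure ℓ] trig ℓ k := by
  classical
  have : Fact (0 < 2 * ℓ) := ⟨by positivity⟩
  have h1 : curveBasis ℓ hℓ k = circleToCurve ℓ (fourierLp 2 k) := by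
    rw [← coe_fourierBasis, ← HilbertBasis.repr_symm_single, ← HilbertBasis.repr_symm_single]
    rfl
  rw [h1]
  filter_upwards [circleToCurve_coe ℓ (fourierLp 2 k),
    (measurePreserving_mk_curveMeasure ℓ).quasiMeasurePreserving.ae (coeFn_fourierLp 2 k)]
    with x hx hx'
  rw [hx, hx', fourier_coe_apply, trig]
  congr 1
  push_cast
  have : (ℓ : ℂ) ≠ 0 := by exact_mod_cast hℓ.ne'
  field_simp

theorem deriv_trig (ℓ : ℝ) (k : ℤ) (x : ℝ) :
    -Complex.I * deriv (trig ℓ k) x = ((Real.pi * k / ℓ : ℝ) : ℂ) * trig ℓ k x := by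
  have h : HasDerivAt (fun x : ℝ => Complex.I * Real.pi * k * x / ℓ)
      (Complex.I * Real.pi * k * 1 / ℓ) x :=
    ((Complex.ofRealCLM.hasDerivAt (x := x)).const_mul _).div_const _
  have h2 : deriv (trig ℓ k) x = _ := h.cexp.deriv
  rw [h2, trig]
  push_cast
  linear_combination (-(Real.pi : ℂ) * k / ℓ * Complex.exp (Complex.I * Real.pi * k * x / ℓ)) *
    Complex.I_mul_I

/-- The maximal diagonal operator in a Hilbert basis, as a graph. -/
def HilbertBasis.diagonalGraph {ι H : Type*} [NormedAddCommGroup H] [InnerProductSpace ℂ H]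
    (b : HilbertBasis ι ℂ H) (lam : ι → ℝ) : Submodule ℂ (H × H) where
  carrier := {q | ∀ i, b.repr q.2 i = (lam i : ℂ) * b.repr q.1 i}
  zero_mem' i := by simp
  add_mem' hp hq i := by simp [hp i, hq i, mul_add]
  smul_mem' c q hq i := by simp [hq i, mul_left_comm]

theorem HilbertBasis.isClosed_diagonalGraph {ι H : Type*} [NormedAddCommGroup H]
    [InnerProductSpace ℂ H] (b : HilbertBasis ι ℂ H) (lam : ι → ℝ) :
    IsClosed (b.diagonalGraph lam : Set (H × H)) := by
  have : (b.diagonalGraph lam : Set (H × H)) =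
      ⋂ i, {q | ⟪b i, q.2⟫_ℂ = (lam i : ℂ) * ⟪b i, q.1⟫_ℂ} := by
    ext q
    simp only [Set.mem_iInter, Set.mem_ofPred_eq, ← b.repr_apply_apply]
    rfl
  rw [this]
  exact isClosed_iInter fun i => isClosed_eq (by fun_prop) (by fun_prop)

theorem HilbertBasis.diagonalGraph_single_valued {ι H : Type*} [NormedAddCommGroup H]
    [InnerProductSpace ℂ H] (b : HilbertBasis ι ℂ H) (lam : ι → ℝ) {q : H × H}
    (hq : q ∈ b.diagonalGraph lam) (h : q.1 = 0) : q.2 = 0 :=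
  b.ext_repr fun i => by rw [hq i, h]; simp

/-- The finite combinations of basis vectors are a core of the maximal diagonal operator. -/
theorem HilbertBasis.topologicalClosure_span_eq_diagonalGraph {ι H : Type*} [NormedAddCommGroup H]
    [InnerProductSpace ℂ H] (b : HilbertBasis ι ℂ H) (lam : ι → ℝ) :
    (Submodule.span ℂ (Set.range fun i => (b i, (lam i : ℂ) • b i))).topologicalClosure =
      b.diagonalGraph lam := by
  classical
  refine le_antisymm (Submodule.topologicalClosure_minimal _ (Submodule.span_le.2 ?_)
    (b.isClosed_diagonalGraph lam)) fun q hq => ?_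
  · rintro _ ⟨i, rfl⟩ j
    simp only [map_smul, b.repr_self, lp.coeFn_smul, Pi.smul_apply, smul_eq_mul]
    rcases eq_or_ne j i with rfl | h
    · rfl
    · simp [lp.single_apply, Pi.single_eq_of_ne h]
  -- On the diagonal graph the expansions of both components have the same partial sums up to the
  -- factors $\lambda_i$, so they converge together in the product.
  · have h : HasSum (fun i => b.repr q.1 i • (b i, (lam i : ℂ) • b i)) q := by
      refine (HasSum.prodMk (b.hasSum_repr q.1) (b.hasSum_repr q.2)).congr_fun ?_
      intro i
      rw [hq i, Prod.smul_mk, smul_smul, mul_comm]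
    refine (Submodule.isClosed_topologicalClosure _).mem_of_tendsto h (.of_forall fun s => ?_)
    exact Submodule.sum_mem _ fun i _ => Submodule.smul_mem _ _
      (Submodule.le_topologicalClosure _ (Submodule.subset_span ⟨i, rfl⟩))

/-- Each $\varphi_k$ is an eigenfunction of $-i\,d/dx$ with eigenvalue $\pi k/\ell$, so the core is
spanned by eigenpairs, and these are dense in the maximal diagonal graph. -/
theorem curveCore_graph (ℓ : ℝ) (hℓ : 0 < ℓ) :
    (curveCore ℓ).closure.graph =
      (curveBasis ℓ hℓ).diagonalGraph fun k => Real.pi * k / ℓ := by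
  set b := curveBasis ℓ hℓ
  set lam : ℤ → ℝ := fun k => Real.pi * k / ℓ
  have hset : {q : CurveSpace ℓ × CurveSpace ℓ | ∃ k : ℤ,
      q.1 =ᵐ[curveMeasure ℓ] trig ℓ k ∧
      q.2 =ᵐ[curveMeasure ℓ] fun x => -Complex.I * deriv (trig ℓ k) x} =
      Set.range fun k => (b k, (lam k : ℂ) • b k) := by
    have h2 : ∀ k, ⇑((lam k : ℂ) • b k) =ᵐ[curveMeasure ℓ]
        fun x => -Complex.I * deriv (trig ℓ k) x := by
      intro k
      filter_upwards [Lp.coeFn_smul (lam k : ℂ) (b k), curveBasis_coe ℓ hℓ k] with x hx hx'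
      rw [hx, Pi.smul_apply, hx', smul_eq_mul, deriv_trig]
    ext ⟨x, y⟩
    simp only [Set.mem_ofPred_eq, Set.mem_range, Prod.mk.injEq]
    refine exists_congr fun k => and_congr ⟨fun h => ?_, fun h => ?_⟩ ⟨fun h => ?_, fun h => ?_⟩
    · exact Lp.ext ((curveBasis_coe ℓ hℓ k).trans h.symm)
    · rw [← h]
      exact curveBasis_coe ℓ hℓ k
    · exact Lp.ext ((h2 k).trans h.symm)
    · rw [← h]
      exact h2 k
  have hcl := b.topologicalClosure_span_eq_diagonalGraph lam
  have hcore : (curveCore ℓ).graph =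
      Submodule.span ℂ (Set.range fun k => (b k, (lam k : ℂ) • b k)) := by
    -- `toLinearPMap` has the given submodule as its graph only if that is single-valued.
    rw [curveCore, hset, Submodule.toLinearPMap_graph_eq]
    intro q hq
    exact b.diagonalGraph_single_valued lam (hcl ▸ Submodule.le_topologicalClosure _ hq)
  -- `closure` leaves a non-closable operator unchanged, so closability must be proved.
  have hclosable : (curveCore ℓ).IsClosable := by
    refine ⟨(b.diagonalGraph lam).toLinearPMap, ?_⟩
    rw [hcore, hcl, Submodule.toLinearPMap_graph_eq]
    exact fun q hq => b.diagonalGraph_single_valued lam hq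
  rw [← hclosable.graph_closure_eq_closure_graph, hcore, hcl]

/-- A multiple of the identity keeps the domain and shifts the eigenvalues. The odd factor $2k+1$
keeps them away from $0$. -/
theorem curveDirac_isDiagonal (ℓ : ℝ) (hℓ : 0 < ℓ) :
    IsDiagonal (curveDirac ℓ) (curveBasis ℓ hℓ) fun k => Real.pi * (2 * k + 1) / (2 * ℓ) := by
  intro x y
  set c : ℂ := ((Real.pi / (2 * ℓ) : ℝ) : ℂ) with hc
  have h1 : (x, y) ∈ (curveDirac ℓ).graph ↔ (x, y - c • x) ∈ (curveCore ℓ).closure.graph := by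
    rw [LinearPMap.mem_graph_iff, LinearPMap.mem_graph_iff]
    constructor
    · rintro ⟨z, rfl, hz⟩
      refine ⟨z, rfl, ?_⟩
      rw [eq_sub_iff_add_eq']
      exact hz
    · rintro ⟨z, rfl, hz⟩
      refine ⟨z, rfl, ?_⟩
      rw [eq_sub_iff_add_eq'] at hz
      exact hz
  rw [h1, curveCore_graph ℓ hℓ]
  refine forall_congr' fun k => ?_
  dsimp only
  rw [map_sub, map_smul, lp.coeFn_sub, Pi.sub_apply, lp.coeFn_smul, Pi.smul_apply, smul_eq_mul,
    sub_eq_iff_eq_add, ← add_mul]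
  have : (((Real.pi * k / ℓ : ℝ) : ℂ) + c) = ((Real.pi * (2 * k + 1) / (2 * ℓ) : ℝ) : ℂ) := by
    rw [hc, ← Complex.ofReal_add]
    congr 1
    field_simp
  rw [this]

/-! ### Direct sums -/

/-- The Hilbert basis of a direct sum of Hilbert spaces which consists of the given bases. -/
theorem exists_hilbertBasis_lp {ι κ : Type*} {G : ι → Type*} [∀ i, NormedAddCommGroup (G i)]
    [∀ i, InnerProductSpace ℂ (G i)] [∀ i, CompleteSpace (G i)] (b : ∀ i, HilbertBasis κ ℂ (G i)) :
    ∃ B : HilbertBasis (ι × κ) ℂ (lp G 2),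
      ∀ (x : lp G 2) (i : ι) (k : κ), B.repr x (i, k) = (b i).repr (x i) k := by
  classical
  set v : ι × κ → lp G 2 := fun q => lp.single 2 q.1 (b q.1 q.2) with hv
  have hvi : ∀ (q : ι × κ) (x : lp G 2), ⟪v q, x⟫_ℂ = (b q.1).repr (x q.1) q.2 := by
    intro q x
    rw [hv, lp.inner_single_left, (b q.1).repr_apply_apply]
  have hon : Orthonormal ℂ v := by
    rw [orthonormal_iff_ite]
    rintro ⟨i, k⟩ ⟨j, l⟩
    rw [hvi]
    rcases eq_or_ne i j with rfl | hij
    · rw [hv]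
      simp only [lp.single_apply_self, (b i).repr_self, lp.single_apply, Pi.single_apply,
        Prod.mk.injEq, true_and]
    · simp [hv, hij]
  have hbot : (Submodule.span ℂ (Set.range v))ᗮ = ⊥ := by
    rw [Submodule.eq_bot_iff]
    intro x hx
    refine lp.ext (funext fun i => (b i).ext_repr fun k => ?_)
    have := (Submodule.mem_orthogonal _ x).1 hx (v (i, k)) (Submodule.subset_span ⟨_, rfl⟩)
    rw [hvi] at this
    rw [this]
    simp
  refine ⟨HilbertBasis.mkOfOrthogonalEqBot hon hbot, fun x i k => ?_⟩
  rw [HilbertBasis.repr_apply_apply, HilbertBasis.coe_mkOfOrthogonalEqBot, hvi]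

theorem exists_isDiagonal_sumDirac {ι : Type*} {ℓ : ι → ℝ} (hℓ : ∀ e, 0 < ℓ e) :
    ∃ B : HilbertBasis (ι × ℤ) ℂ (CurveSum ℓ),
      IsDiagonal (sumDirac ℓ) B fun q => Real.pi * (2 * q.2 + 1) / (2 * ℓ q.1) := by
  obtain ⟨B, hB⟩ := exists_hilbertBasis_lp fun e => curveBasis (ℓ e) (hℓ e)
  refine ⟨B, fun x y => ?_⟩
  rw [sumDirac, Submodule.toLinearPMap_graph_eq]
  · rw [Prod.forall]
    refine forall_congr' fun e => (curveDirac_isDiagonal (ℓ e) (hℓ e) _ _).trans ?_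
    simp only [hB]
  · intro q hq h0
    refine lp.ext (funext fun e => (curveDirac (ℓ e)).graph_fst_eq_zero_snd (hq e) ?_)
    rw [h0]
    rfl

theorem curveTriple_dimension {ι X : Type*} [TopologicalSpace X] [CompactSpace X] {ℓ : ι → ℝ}
    (hℓ : ∀ e, 0 < ℓ e) (R : ι → C(ℝ, X)) :
    (curveTriple ℓ R).dimension = sInf {d | ∃ p : ℝ, 0 < p ∧ d = ENNReal.ofReal p ∧
      ∑' (e : ι) (k : ℤ),
        ENNReal.ofReal ((1 + (Real.pi * (2 * k + 1) / (2 * ℓ e)) ^ 2)⁻¹ ^ (p / 2)) < ∞} := by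
  obtain ⟨B, hB⟩ := exists_isDiagonal_sumDirac hℓ
  rw [(curveTriple ℓ R).dimension_eq_of_isDiagonal hB]
  simp only [ENNReal.tsum_prod']

end Curve

end

noncomputable section

namespace StretchedGasket

/-! ### The dimension `d_α` -/

/-- `d_α = log 3 / (log 2 - log (1 - α))`. -/
def gasketDim (α : ℝ) : ℝ := Real.log 3 / (Real.log 2 - Real.log (1 - α))

theorem gasketDim_eq {α : ℝ} (hα : α ∈ Set.Ioo (0 : ℝ) (1 / 3)) :
    gasketDim α = Real.log 3 / -Real.log ((1 - α) / 2) := by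
  rw [gasketDim, Real.log_div (by linarith [hα.2]) (by norm_num), neg_sub]

theorem scale_pos {α : ℝ} (hα : α ∈ Set.Ioo (0 : ℝ) (1 / 3)) : 0 < (1 - α) / 2 := by linarith [hα.2]

theorem scale_lt_one {α : ℝ} (hα : α ∈ Set.Ioo (0 : ℝ) (1 / 3)) :
    (1 - α) / 2 < 1 := by linarith [hα.1]

theorem neg_log_scale_pos {α : ℝ} (hα : α ∈ Set.Ioo (0 : ℝ) (1 / 3)) :
    0 < -Real.log ((1 - α) / 2) :=
  neg_pos.2 (Real.log_neg (scale_pos hα) (scale_lt_one hα))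

/-- This is where $\alpha<1/3$ matters: it says $c>1/3$. It makes both the sum over $k$ and the
one-dimensional joining pieces harmless. -/
theorem one_lt_gasketDim {α : ℝ} (hα : α ∈ Set.Ioo (0 : ℝ) (1 / 3)) : 1 < gasketDim α := by
  rw [gasketDim_eq hα, one_lt_div (neg_log_scale_pos hα), ← Real.log_inv]
  refine Real.log_lt_log (inv_pos.2 (scale_pos hα)) ?_
  rw [inv_lt_comm₀ (scale_pos hα) (by norm_num)]
  linarith [hα.2]

theorem scale_rpow_eq {α : ℝ} (hα : α ∈ Set.Ioo (0 : ℝ) (1 / 3)) (p : ℝ) :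
    ((1 - α) / 2) ^ p = (3 : ℝ)⁻¹ ^ (p / gasketDim α) := by
  have h1 := neg_log_scale_pos hα
  have h3 : Real.log 3 ≠ 0 := (Real.log_pos (by norm_num)).ne'
  rw [Real.rpow_def_of_pos (scale_pos hα), Real.rpow_def_of_pos (by norm_num), Real.log_inv,
    gasketDim_eq hα]
  congr 1
  field_simp

theorem scale_rpow_gasketDim {α : ℝ} (hα : α ∈ Set.Ioo (0 : ℝ) (1 / 3)) :
    ((1 - α) / 2) ^ gasketDim α = (3 : ℝ)⁻¹ := by
  rw [scale_rpow_eq hα, div_self (by linarith [one_lt_gasketDim hα]), Real.rpow_one]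

theorem three_mul_scale_rpow_lt_one_iff {α : ℝ} (hα : α ∈ Set.Ioo (0 : ℝ) (1 / 3)) {p : ℝ} :
    3 * ENNReal.ofReal (((1 - α) / 2) ^ p) < 1 ↔ gasketDim α < p := by
  have h1 := one_lt_gasketDim hα
  have h3 : (3 : ℝ≥0∞) = ENNReal.ofReal 3 := by simp
  rw [h3, ← ENNReal.ofReal_mul (by norm_num), ENNReal.ofReal_lt_one,
    ← lt_inv_mul_iff₀ (by norm_num), mul_one, scale_rpow_eq hα]
  nth_rw 2 [← Real.rpow_one (3 : ℝ)⁻¹]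
  rw [Real.rpow_lt_rpow_left_iff_of_base_lt_one (by norm_num) (by norm_num),
    one_lt_div (by linarith)]

/-! ### Sums over the edges -/

/-- There are $3^n$ words of length $n$, which gives a geometric series. For $3x\ge1$ truncated
subtraction makes the right side $0^{-1}=\infty$, as it should be. -/
theorem tsum_pow_length (x : ℝ≥0∞) : ∑' w : List (Fin 3), x ^ w.length = (1 - 3 * x)⁻¹ := by
  rw [← List.equivSigmaTuple.symm.tsum_eq, ENNReal.tsum_sigma', ← ENNReal.tsum_geometric]
  refine tsum_congr fun n => ?_
  simp [List.equivSigmaTuple, tsum_fintype, mul_pow]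

/-- Edges are pairs of a word and an index, of two kinds. -/
def Edge.equivSum : (List (Fin 3) × Fin 3) ⊕ (List (Fin 3) × Fin 3) ≃ Edge where
  toFun := Sum.elim (fun q => .tri q.1 q.2) (fun q => .join q.1 q.2)
  invFun
    | .tri w i => .inl (w, i)
    | .join w i => .inr (w, i)
  left_inv := by rintro (_ | _) <;> rfl
  right_inv := by rintro (_ | _) <;> rfl

theorem Edge.tsum_eq (g : Edge → ℝ≥0∞) :
    ∑' e, g e = ∑' (w : List (Fin 3)), ∑ i, (g (.tri w i) + g (.join w i)) := by
  rw [← Edge.equivSum.tsum_eq, Summable.tsum_sum ENNReal.summable ENNReal.summable,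
    ENNReal.tsum_prod', ENNReal.tsum_prod', ← ENNReal.tsum_add]
  refine tsum_congr fun w => ?_
  rw [tsum_fintype, tsum_fintype, ← Finset.sum_add_distrib]
  rfl

theorem ofReal_len_tri_rpow {α : ℝ} (hα : α ∈ Set.Ioo (0 : ℝ) (1 / 3))
    (w : List (Fin 3)) (i : Fin 3) (p : ℝ) :
    ENNReal.ofReal ((Edge.tri w i).len α ^ p) =
      ENNReal.ofReal (((1 - α) / 2) ^ p) ^ w.length := by
  rw [Edge.len_tri hα, ← ENNReal.ofReal_pow (Real.rpow_nonneg (scale_pos hα).le p),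
    Real.rpow_pow_comm (scale_pos hα).le]

theorem ofReal_len_join_rpow_le {α : ℝ} (hα : α ∈ Set.Ioo (0 : ℝ) (1 / 3))
    (w : List (Fin 3)) (i : Fin 3) {p : ℝ} (hp : 0 < p) :
    ENNReal.ofReal ((Edge.join w i).len α ^ p) ≤
      ENNReal.ofReal (((1 - α) / 2) ^ p) ^ w.length := by
  rw [← ofReal_len_tri_rpow hα w i]
  refine ENNReal.ofReal_le_ofReal (Real.rpow_le_rpow (Edge.len_pos hα _).le ?_ hp.le)
  rw [Edge.len_tri hα, Edge.len_join hα]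
  exact mul_le_of_le_one_left (pow_nonneg (scale_pos hα).le _) (by linarith [hα.2])

theorem tsum_len_rpow_lt_top {α : ℝ} (hα : α ∈ Set.Ioo (0 : ℝ) (1 / 3))
    {p : ℝ} (hp : gasketDim α < p) :
    ∑' e : Edge, ENNReal.ofReal (e.len α ^ p) < ∞ := by
  have hp0 : 0 < p := by linarith [one_lt_gasketDim hα]
  rw [Edge.tsum_eq]
  -- The factor $6$ counts three sides and three joining edges per word.
  calc _ ≤ ∑' w : List (Fin 3), 6 * ENNReal.ofReal (((1 - α) / 2) ^ p) ^ w.length := by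
        refine ENNReal.tsum_le_tsum fun w => ?_
        refine (Finset.sum_le_sum fun i _ => add_le_add (ofReal_len_tri_rpow hα w i p).le
          (ofReal_len_join_rpow_le hα w i hp0)).trans (le_of_eq ?_)
        rw [Finset.sum_const, ← two_mul, Finset.card_univ, Fintype.card_fin, nsmul_eq_mul,
          ← mul_assoc]
        norm_num
    _ < ∞ := by
        rw [ENNReal.tsum_mul_left, tsum_pow_length]
        refine ENNReal.mul_lt_top (by finiteness) (ENNReal.inv_lt_top.2 ?_)
        exact tsub_pos_of_lt ((three_mul_scale_rpow_lt_one_iff hα).2 hp)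

theorem tsum_odd_rpow_lt_top {p : ℝ} (hp : 1 < p) :
    ∑' k : ℤ, ENNReal.ofReal (|(2 * k + 1 : ℝ)| ^ (-p)) < ∞ := by
  have h := (Real.summable_abs_int_rpow hp).comp_injective
    (i := fun k : ℤ => 2 * k + 1) (fun a b hab => by simpa using hab)
  have h2 : Summable fun k : ℤ => |(2 * k + 1 : ℝ)| ^ (-p) := by
    refine h.congr fun k => ?_
    simp
  rw [← ENNReal.ofReal_tsum_of_nonneg (fun _ => Real.rpow_nonneg (abs_nonneg _) _) h2]
  exact ENNReal.ofReal_lt_top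

/-- Since $\pi/2\ge1$, dropping the summand $1$ leaves $1+\lambda^2\ge((2k+1)/\ell)^2$. -/
theorem eigenvalue_term_le {ℓ p : ℝ} (hℓ : 0 < ℓ) (hp : 0 < p) (k : ℤ) :
    (1 + (Real.pi * (2 * k + 1) / (2 * ℓ)) ^ 2)⁻¹ ^ (p / 2) ≤
      ℓ ^ p * |(2 * k + 1 : ℝ)| ^ (-p) := by
  have hk : 0 < |(2 * k + 1 : ℝ)| := by
    rw [abs_pos]
    have : 2 * k + 1 ≠ 0 := by omega
    exact_mod_cast this
  have h1 : (ℓ / |(2 * k + 1 : ℝ)|) ^ p = ((ℓ / |(2 * k + 1 : ℝ)|) ^ 2) ^ (p / 2) := by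
    rw [← Real.rpow_natCast, ← Real.rpow_mul (by positivity)]
    congr 1
    push_cast
    ring
  rw [Real.rpow_neg hk.le, ← div_eq_mul_inv, ← Real.div_rpow hℓ.le hk.le, h1]
  refine Real.rpow_le_rpow (by positivity) ?_ (by positivity)
  rw [inv_le_comm₀ (by positivity) (by positivity), ← inv_pow, inv_div, div_pow, sq_abs, div_pow,
    mul_pow]
  have hpi : 4 ≤ Real.pi ^ 2 := by nlinarith [Real.two_le_pi]
  have : (2 * k + 1 : ℝ) ^ 2 / ℓ ^ 2 ≤ Real.pi ^ 2 * (2 * k + 1) ^ 2 / (2 * ℓ) ^ 2 := by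
    rw [mul_pow, div_le_div_iff₀ (by positivity) (by positivity)]
    nlinarith [mul_nonneg (sq_nonneg (2 * k + 1 : ℝ)) (sq_nonneg ℓ)]
  linarith

/-- With $\ell\le1$ and $\pi\le4$ one has $1+\pi^2/(4\ell^2)\le5/\ell^2$. -/
theorem le_eigenvalue_term {ℓ p : ℝ} (hℓ : 0 < ℓ) (hℓ1 : ℓ ≤ 1) (hp : 0 < p) :
    ℓ ^ p * 5⁻¹ ^ (p / 2) ≤ (1 + (Real.pi * (2 * (0 : ℤ) + 1) / (2 * ℓ)) ^ 2)⁻¹ ^ (p / 2) := by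
  have h1 : ℓ ^ p = (ℓ ^ 2) ^ (p / 2) := by
    rw [← Real.rpow_natCast, ← Real.rpow_mul hℓ.le]
    congr 1
    push_cast
    ring
  rw [h1, ← Real.mul_rpow (by positivity) (by norm_num)]
  refine Real.rpow_le_rpow (by positivity) ?_ (by positivity)
  rw [le_inv_comm₀ (by positivity) (by positivity)]
  have hpi : Real.pi ^ 2 ≤ 16 := by nlinarith [Real.pi_le_four, Real.pi_pos]
  have hl : ℓ ^ 2 ≤ 1 := by nlinarith
  have hr : (ℓ ^ 2 * 5⁻¹)⁻¹ = 5 / ℓ ^ 2 := by field_simp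
  rw [hr, le_div_iff₀ (by positivity)]
  have : (1 + (Real.pi * (2 * (0 : ℤ) + 1) / (2 * ℓ)) ^ 2) * ℓ ^ 2 = ℓ ^ 2 + Real.pi ^ 2 / 4 := by
    push_cast
    field_simp
    ring
  rw [this]
  linarith

theorem tsum_eigenvalues_lt_top_iff {α : ℝ} (hα : α ∈ Set.Ioo (0 : ℝ) (1 / 3)) {p : ℝ}
    (hp : 0 < p) :
    ∑' (e : Edge) (k : ℤ), ENNReal.ofReal
      ((1 + (Real.pi * (2 * k + 1) / (2 * e.len α)) ^ 2)⁻¹ ^ (p / 2)) < ∞ ↔ gasketDim α < p := by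
  constructor
  · intro h
    rw [← three_mul_scale_rpow_lt_one_iff hα]
    by_contra! hle
    refine h.ne (top_le_iff.1 ?_)
    -- One side of each triangle and the single eigenvalue $k=0$ already force divergence.
    calc ∞ = ∑' w : List (Fin 3), ENNReal.ofReal ((Edge.tri w 0).len α ^ p) *
            ENNReal.ofReal (5⁻¹ ^ (p / 2)) := by
          simp only [ofReal_len_tri_rpow hα]
          rw [ENNReal.tsum_mul_right, tsum_pow_length, tsub_eq_zero_of_le hle, ENNReal.inv_zero,
            ENNReal.top_mul]
          rw [Ne, ENNReal.ofReal_eq_zero, not_le]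
          positivity
      _ ≤ ∑' w : List (Fin 3), ∑' k : ℤ, ENNReal.ofReal
            ((1 + (Real.pi * (2 * k + 1) / (2 * (Edge.tri w 0).len α)) ^ 2)⁻¹ ^ (p / 2)) := by
          refine ENNReal.tsum_le_tsum fun w => ?_
          have hpos := Edge.len_pos hα (.tri w 0)
          have hle1 : (Edge.tri w 0).len α ≤ 1 := by
            rw [Edge.len_tri hα]
            exact pow_le_one₀ (scale_pos hα).le (scale_lt_one hα).le
          rw [← ENNReal.ofReal_mul (by positivity)]
          exact (ENNReal.ofReal_le_ofReal (le_eigenvalue_term hpos hle1 hp)).trans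
            (ENNReal.le_tsum (f := fun k : ℤ => ENNReal.ofReal
              ((1 + (Real.pi * (2 * k + 1) / (2 * (Edge.tri w 0).len α)) ^ 2)⁻¹ ^ (p / 2))) 0)
      _ ≤ _ := ENNReal.tsum_comp_le_tsum_of_injective (f := fun w : List (Fin 3) => Edge.tri w 0)
          (fun a b hab => by simpa using hab) _
  · intro hdp
    calc _ ≤ ∑' (e : Edge) (k : ℤ), ENNReal.ofReal (e.len α ^ p) *
            ENNReal.ofReal (|(2 * k + 1 : ℝ)| ^ (-p)) := by
          refine ENNReal.tsum_le_tsum fun e => ENNReal.tsum_le_tsum fun k => ?_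
          rw [← ENNReal.ofReal_mul (Real.rpow_nonneg (Edge.len_pos hα e).le _)]
          exact ENNReal.ofReal_le_ofReal (eigenvalue_term_le (Edge.len_pos hα e) hp k)
      _ < ∞ := by
          simp only [ENNReal.tsum_mul_left, ENNReal.tsum_mul_right]
          exact ENNReal.mul_lt_top (tsum_len_rpow_lt_top hα hdp)
            (tsum_odd_rpow_lt_top ((one_lt_gasketDim hα).trans hdp))

theorem spectralTriple_dimension {α : ℝ} (hα : α ∈ Set.Ioo (0 : ℝ) (1 / 3)) :
    (spectralTriple hα).dimension = ENNReal.ofReal (gasketDim α) := by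
  have h1 := one_lt_gasketDim hα
  rw [spectralTriple, curveTriple_dimension fun e => Edge.len_pos hα e]
  -- The trace diverges at $p=d_\alpha$ itself, so the upper bound uses exponents slightly larger.
  refine le_antisymm (le_of_forall_gt_imp_ge_of_dense fun c hc => ?_) (le_sInf ?_)
  · obtain ⟨p, hp0, hp1, hp2⟩ := ENNReal.lt_iff_exists_real_btwn.1 hc
    have hp : gasketDim α < p := (ENNReal.ofReal_lt_ofReal_iff_of_nonneg (by linarith)).1 hp1
    have hp' : 0 < p := by linarith
    refine le_trans (sInf_le ?_) hp2.le
    exact ⟨p, hp', rfl, (tsum_eigenvalues_lt_top_iff hα hp').2 hp⟩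
  · rintro _ ⟨p, hp, rfl, h⟩
    exact ENNReal.ofReal_le_ofReal ((tsum_eigenvalues_lt_top_iff hα hp).1 h).le

end StretchedGasket

end

noncomputable section

namespace StretchedGasket

/-! ### The lower bound of the Hausdorff dimension -/

theorem F_castAdd_eq (α : ℝ) (j : Fin 3) (x : Plane) :
    F α (Fin.castAdd 3 j) x = (1 - (1 - α) / 2) • vtx j + ((1 - α) / 2) • x := by
  have h1 := F_castAdd_sub α j x (vtx j)
  have h2 : F α (Fin.castAdd 3 j) (vtx j) = vtx j := by simp [F, vtx]
  rw [h2, sub_eq_iff_eq_add] at h1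
  rw [h1]
  module

/-- The point with the address `a` of the self-similar set of the first three maps. -/
def code (α : ℝ) (a : ℕ → Fin 3) : Plane :=
  ∑' n, ((1 - (1 - α) / 2) * ((1 - α) / 2) ^ n) • vtx (a n)

theorem norm_code_term_le {α : ℝ} (hα : α ∈ Set.Ioo (0 : ℝ) (1 / 3)) (a : ℕ → Fin 3) (n : ℕ) :
    ‖((1 - (1 - α) / 2) * ((1 - α) / 2) ^ n) • vtx (a n)‖ ≤
      ((1 - (1 - α) / 2) * ((1 - α) / 2) ^ n) * ∑ i, ‖vtx i‖ := by
  have h0 := scale_pos hα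
  have h1 := scale_lt_one hα
  have h2 : 0 ≤ (1 - (1 - α) / 2) * ((1 - α) / 2) ^ n :=
    mul_nonneg (by linarith) (pow_nonneg h0.le _)
  rw [norm_smul, Real.norm_of_nonneg h2]
  exact mul_le_mul_of_nonneg_left
    (Finset.single_le_sum (f := fun i => ‖vtx i‖) (fun i _ => norm_nonneg _) (Finset.mem_univ _)) h2

theorem summable_code_bound {α : ℝ} (hα : α ∈ Set.Ioo (0 : ℝ) (1 / 3)) :
    Summable fun n : ℕ => ((1 - (1 - α) / 2) * ((1 - α) / 2) ^ n) * ∑ i, ‖vtx i‖ :=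
  ((summable_geometric_of_lt_one (scale_pos hα).le (scale_lt_one hα)).mul_left _).mul_right _

theorem code_eq {α : ℝ} (hα : α ∈ Set.Ioo (0 : ℝ) (1 / 3)) (a : ℕ → Fin 3) :
    code α a = (1 - (1 - α) / 2) • vtx (a 0) + ((1 - α) / 2) • code α fun n => a (n + 1) := by
  have hs : ∀ a : ℕ → Fin 3,
      Summable fun n => ((1 - (1 - α) / 2) * ((1 - α) / 2) ^ n) • vtx (a n) := fun a =>
    .of_norm_bounded (summable_code_bound hα) (norm_code_term_le hα a)
  rw [code, (hs a).tsum_eq_zero_add, code, ← Summable.tsum_const_smul _ (hs _)]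
  congr 1
  · simp
  · refine tsum_congr fun n => ?_
    rw [smul_smul]
    congr 1
    ring

/-- The series converges uniformly by the geometric bound. As the address space is compact, the
range is compact and coordinates attain their extrema on it. -/
theorem continuous_code {α : ℝ} (hα : α ∈ Set.Ioo (0 : ℝ) (1 / 3)) : Continuous (code α) := by
  refine continuous_tsum (fun n => ?_) (summable_code_bound hα) fun n a => norm_code_term_le hα a n
  have : Continuous vtx := continuous_of_discreteTopology
  fun_prop

theorem range_code_subset {α : ℝ} (hα : α ∈ Set.Ioo (0 : ℝ) (1 / 3)) :
    Set.range (code α) ⊆ gasket hα := by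
  refine subset_gasket hα (isCompact_range (continuous_code hα)) ?_
  rintro _ ⟨a, rfl⟩
  refine Set.mem_iUnion.2 ⟨Fin.castAdd 3 (a 0), code α fun n => a (n + 1), ⟨_, rfl⟩, ?_⟩
  rw [F_castAdd_eq, code_eq hα a]

theorem code_sub_code {α : ℝ} (hα : α ∈ Set.Ioo (0 : ℝ) (1 / 3))
    {n : ℕ} {a b : ℕ → Fin 3} (h : ∀ i < n, a i = b i) :
    code α a - code α b =
      ((1 - α) / 2) ^ n • (code α (fun i => a (i + n)) - code α fun i => b (i + n)) := by
  induction n generalizing a b with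
  | zero => simp
  | succ n ih =>
    rw [code_eq hα a, code_eq hα b, h 0 n.succ_pos, add_sub_add_left_eq_sub, ← smul_sub,
      ih (fun i hi => h (i + 1) (by omega)), smul_smul, pow_succ']
    simp only [add_assoc]

/-- The barycentric coordinates in the triangle. -/
def bary (j : Fin 3) (x : Plane) : ℝ :=
  ![1 - x 0 - x 1 / √3, 2 * x 1 / √3, x 0 - x 1 / √3] j

theorem bary_combo (j : Fin 3) (s : ℝ) (x y : Plane) :
    bary j ((1 - s) • x + s • y) = (1 - s) * bary j x + s * bary j y := by
  fin_cases j <;> simp [bary] <;> ring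

theorem bary_vtx (j i : Fin 3) : bary j (vtx i) = if i = j then 1 else 0 := by
  have h3 : √3 ≠ 0 := by positivity
  fin_cases j <;> fin_cases i <;> simp [bary, vtx, pt] <;> field_simp <;> norm_num

theorem continuous_bary (j : Fin 3) : Continuous (bary j) := by
  unfold bary
  fin_cases j <;> simp <;> fun_prop

theorem abs_bary_sub_le (j : Fin 3) (x y : Plane) : |bary j x - bary j y| ≤ 2 * dist x y := by
  have h3 : 1 ≤ √3 := Real.one_le_sqrt.2 (by norm_num)
  have hx : ∀ i : Fin 2, |x i - y i| ≤ dist x y := fun i => by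
    rw [dist_eq_norm, ← Real.norm_eq_abs]
    exact PiLp.norm_apply_le (x - y) i
  have h0 := hx 0
  have h1 : |(x 1 - y 1) / √3| ≤ dist x y := by
    rw [abs_div, abs_of_nonneg (Real.sqrt_nonneg 3)]
    exact (div_le_self (abs_nonneg _) h3).trans (hx 1)
  rw [sub_div] at h1
  rw [abs_le] at *
  fin_cases j <;> simp [bary, mul_div_assoc] <;> constructor <;> linarith

theorem exists_first_ne {β : Type*} {a b : ℕ → β} (h : a ≠ b) :
    ∃ n, (∀ i < n, a i = b i) ∧ a n ≠ b n := by
  classical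
  have h' : ∃ n, a n ≠ b n := Function.ne_iff.1 h
  exact ⟨Nat.find h', fun i hi => not_not.1 (Nat.find_min h' hi), Nat.find_spec h'⟩

theorem bary_code {α : ℝ} (hα : α ∈ Set.Ioo (0 : ℝ) (1 / 3)) (j : Fin 3) (a : ℕ → Fin 3) :
    bary j (code α a) = (1 - (1 - α) / 2) * (if a 0 = j then 1 else 0) +
      (1 - α) / 2 * bary j (code α fun n => a (n + 1)) := by
  rw [code_eq hα a, bary_combo, bary_vtx]

/-- At a minimum $m$ the recursion `bary_code` gives $m\ge cm$, and at a maximum $M$ it gives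
$M\le(1-c)+cM$; both conclude by $c<1$. -/
theorem bary_code_mem {α : ℝ} (hα : α ∈ Set.Ioo (0 : ℝ) (1 / 3))
    (j : Fin 3) (a : ℕ → Fin 3) : bary j (code α a) ∈ Set.Icc (0 : ℝ) 1 := by
  have hc : Continuous fun a => bary j (code α a) := (continuous_bary j).comp (continuous_code hα)
  have h0 := scale_pos hα
  have h1 := scale_lt_one hα
  obtain ⟨u, -, hu⟩ := isCompact_univ.exists_isMinOn Set.univ_nonempty hc.continuousOn
  obtain ⟨v, -, hv⟩ := isCompact_univ.exists_isMaxOn Set.univ_nonempty hc.continuousOn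
  have hu' : ∀ a, bary j (code α u) ≤ bary j (code α a) := fun a => hu (Set.mem_univ a)
  have hv' : ∀ a, bary j (code α a) ≤ bary j (code α v) := fun a => hv (Set.mem_univ a)
  have hu1 := bary_code hα j u
  have hv1 := bary_code hα j v
  have hu2 := hu' fun n => u (n + 1)
  have hv2 := hv' fun n => v (n + 1)
  refine ⟨le_trans ?_ (hu' a), (hv' a).trans ?_⟩
  · split_ifs at hu1 <;> nlinarith
  · split_ifs at hv1 <;> nlinarith

/-- After removal of the common prefix, the coordinate belonging to $a_n$ is at least $1-c$ at one
point and at most $c$ at the other. The gap is $1-2c=\alpha$; the factor $1/2$ comes from the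
Lipschitz constant in `abs_bary_sub_le`. -/
theorem le_dist_code {α : ℝ} (hα : α ∈ Set.Ioo (0 : ℝ) (1 / 3))
    {n : ℕ} {a b : ℕ → Fin 3} (h : ∀ i < n, a i = b i) (hn : a n ≠ b n) :
    α / 2 * ((1 - α) / 2) ^ n ≤ dist (code α a) (code α b) := by
  have h0 := scale_pos hα
  rw [dist_eq_norm, code_sub_code hα h, norm_smul, Real.norm_of_nonneg (pow_nonneg h0.le _),
    mul_comm]
  refine mul_le_mul_of_nonneg_left ?_ (pow_nonneg h0.le _)
  rw [← dist_eq_norm]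
  set a' : ℕ → Fin 3 := fun i => a (i + n)
  set b' : ℕ → Fin 3 := fun i => b (i + n)
  have hab : b' 0 ≠ a' 0 := by simpa [a', b'] using hn.symm
  have h1 := bary_code hα (a' 0) a'
  have h2 := bary_code hα (a' 0) b'
  rw [if_pos rfl] at h1
  rw [if_neg hab] at h2
  have h3 := (bary_code_mem hα (a' 0) fun n => a' (n + 1)).1
  have h4 := (bary_code_mem hα (a' 0) fun n => b' (n + 1)).2
  have h5 := (le_abs_self _).trans (abs_bary_sub_le (a' 0) (code α a') (code α b'))
  nlinarith

theorem code_injective {α : ℝ} (hα : α ∈ Set.Ioo (0 : ℝ) (1 / 3)) :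
    Function.Injective (code α) := by
  intro a b hab
  by_contra h
  obtain ⟨n, h1, h2⟩ := exists_first_ne h
  have h3 := le_dist_code hα h1 h2
  rw [hab, dist_self] at h3
  have : 0 < α / 2 * ((1 - α) / 2) ^ n := mul_pos (by linarith [hα.1]) (pow_pos (scale_pos hα) _)
  linarith

/-- The map from the self-similar set to the interval which reads addresses as ternary expansions is
Hölder continuous with exponent `d_α`. -/
theorem holderOnWith_ofDigits_code {α : ℝ} (hα : α ∈ Set.Ioo (0 : ℝ) (1 / 3)) :
    HolderOnWith (Real.toNNReal ((2 / α) ^ gasketDim α)) (Real.toNNReal (gasketDim α))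
      (fun x => Real.ofDigits (Function.invFun (code α) x)) (Set.range (code α)) := by
  have hd : 0 ≤ gasketDim α := by linarith [one_lt_gasketDim hα]
  have hα0 := hα.1
  have h0 := scale_pos hα
  rintro _ ⟨a, rfl⟩ _ ⟨b, rfl⟩
  simp only [Function.leftInverse_invFun (code_injective hα) _, Real.coe_toNNReal _ hd]
  rcases eq_or_ne a b with rfl | hab
  · simp
  obtain ⟨n, h1, h2⟩ := exists_first_ne hab
  rw [edist_dist, edist_dist, ENNReal.ofReal_rpow_of_nonneg dist_nonneg hd]
  change _ ≤ ENNReal.ofReal _ * _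
  rw [← ENNReal.ofReal_mul (by positivity)]
  refine ENNReal.ofReal_le_ofReal ?_
  rw [Real.dist_eq, ← Real.mul_rpow (by positivity) dist_nonneg]
  refine (Real.abs_ofDigits_sub_ofDigits_le h1).trans ?_
  -- Expansions sharing $n$ digits differ by at most $3^{-n}=(c^n)^{d_\alpha}$, while the points are
  -- at least $\tfrac{\alpha}{2}c^n$ apart; this explains the Hölder constant.
  have h3 : (((3 : ℕ) : ℝ) ^ n)⁻¹ = (((1 - α) / 2) ^ n) ^ gasketDim α := by
    rw [← Real.rpow_pow_comm h0.le, scale_rpow_gasketDim hα, inv_pow]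
    norm_num
  rw [h3]
  refine Real.rpow_le_rpow (pow_nonneg h0.le _) ?_ hd
  have h4 := le_dist_code hα h1 h2
  calc ((1 - α) / 2) ^ n = 2 / α * (α / 2 * ((1 - α) / 2) ^ n) := by field_simp
    _ ≤ _ := mul_le_mul_of_nonneg_left h4 (by positivity)

/-- Every $t\in[0,1]$ has a ternary expansion, so the Hölder image covers an interval; its dimension
$1$ is at most the dimension of the source divided by $d_\alpha$. -/
theorem gasketDim_le_dimH {α : ℝ} (hα : α ∈ Set.Ioo (0 : ℝ) (1 / 3)) :
    ENNReal.ofReal (gasketDim α) ≤ dimH (gasket hα) := by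
  have hd : 0 < gasketDim α := by linarith [one_lt_gasketDim hα]
  have hd' : 0 < Real.toNNReal (gasketDim α) := Real.toNNReal_pos.2 hd
  have h1 := (holderOnWith_ofDigits_code hα).dimH_image_le hd'
  have h2 : Set.Icc (0 : ℝ) 1 ⊆
      (fun x => Real.ofDigits (Function.invFun (code α) x)) '' Set.range (code α) := by
    intro t ht
    obtain ⟨a, -, rfl⟩ := Real.ofDigits_SurjOn (b := 3) (by norm_num) ht
    exact ⟨code α a, ⟨a, rfl⟩, by
      simp only [Function.leftInverse_invFun (code_injective hα) _]⟩
  have h3 : dimH (Set.Icc (0 : ℝ) 1) = 1 := by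
    rw [Real.dimH_of_nonempty_interior (by simp)]
    simp
  have h4 := (h3.symm.le.trans (dimH_mono h2)).trans h1
  rw [ENNReal.le_div_iff_mul_le (Or.inl (by simpa using hd)) (Or.inl ENNReal.coe_ne_top),
    one_mul] at h4
  exact h4.trans (dimH_mono (range_code_subset hα))

/-! ### The upper bound of the Hausdorff dimension -/

/-- The linear parts of the joining maps have rank one. -/
theorem exists_F_natAdd_eq (α : ℝ) (i : Fin 3) :
    ∃ u v : Plane, ∀ x, ∃ t : ℝ, F α (Fin.natAdd 3 i) x = u + t • v := by
  refine ⟨pt (Fin.natAdd 3 i), ![!₂[1, -√3], !₂[1, 0], !₂[1, √3]] i, fun x => ?_⟩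
  suffices ∀ y : Plane, ∃ t : ℝ, (WithLp.toLp 2 (mat α (Fin.natAdd 3 i) *ᵥ y.ofLp) : Plane) =
      t • ![!₂[1, -√3], !₂[1, 0], !₂[1, √3]] i by
    obtain ⟨t, ht⟩ := this (x - pt (Fin.natAdd 3 i))
    exact ⟨t, by rw [F, ht, add_comm]⟩
  intro y
  have h3 : √3 ^ 2 = (3 : ℝ) := Real.sq_sqrt (by norm_num)
  refine ⟨![α / 4 * (y 0 - √3 * y 1), α * y 0, α / 4 * (y 0 + √3 * y 1)] i, ?_⟩
  fin_cases i <;> ext k <;> fin_cases k <;>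
    simp [mat, Matrix.vecHead, Matrix.vecTail] <;> ring_nf <;> (try rw [h3]) <;> ring_nf

theorem dimH_range_line_le (u v : Plane) : dimH (Set.range fun t : ℝ => u + t • v) ≤ 1 := by
  have h : ContDiff ℝ 1 fun t : ℝ => u + t • v := by fun_prop
  simpa using h.dimH_range_le

theorem lipschitzWith_wordMap {α : ℝ} (hα : α ∈ Set.Ioo (0 : ℝ) (1 / 3)) (w : List (Fin 3)) :
    LipschitzWith (Real.toNNReal ((1 - α) / 2) ^ w.length) (wordMap α w) := by
  refine LipschitzWith.of_dist_le_mul fun x y => le_of_eq ?_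
  have h0 := scale_pos hα
  rw [dist_eq_norm, dist_eq_norm, wordMap_sub, norm_smul, Real.norm_of_nonneg (pow_nonneg h0.le _),
    NNReal.coe_pow, Real.coe_toNNReal _ h0.le]

theorem dimH_wordMap_joining_le {α : ℝ} (hα : α ∈ Set.Ioo (0 : ℝ) (1 / 3))
    (w : List (Fin 3)) (i : Fin 3) :
    dimH (wordMap α w '' (F α (Fin.natAdd 3 i) '' gasket hα)) ≤ 1 := by
  obtain ⟨u, v, h⟩ := exists_F_natAdd_eq α i
  refine ((lipschitzWith_wordMap hα w).dimH_image_le _).trans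
    (le_trans (dimH_mono ?_) (dimH_range_line_le u v))
  rintro _ ⟨x, -, rfl⟩
  obtain ⟨t, ht⟩ := h x
  exact ⟨t, ht.symm⟩

/-- The points which lie in triangles of all levels. -/
def cantorPart {α : ℝ} (hα : α ∈ Set.Ioo (0 : ℝ) (1 / 3)) : Set Plane :=
  {x | ∀ n, ∃ w : List.Vector (Fin 3) n, x ∈ wordMap α w.1 '' gasket hα}

/-- If $x=F_w(y)$ with $y\in K_\alpha$, then $y$ lies in some $F_j(K_\alpha)$: a similarity extends
the word by one letter, a joining map puts $x$ into the second part. -/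
theorem gasket_subset {α : ℝ} (hα : α ∈ Set.Ioo (0 : ℝ) (1 / 3)) : gasket hα ⊆ cantorPart hα ∪
    ⋃ q : List (Fin 3) × Fin 3, wordMap α q.1 '' (F α (Fin.natAdd 3 q.2) '' gasket hα) := by
  intro x hx
  by_contra hcon
  rw [Set.mem_union, not_or] at hcon
  obtain ⟨h1, h2⟩ := hcon
  refine h1 fun n => ?_
  induction n with
  | zero => exact ⟨⟨[], rfl⟩, x, hx, rfl⟩
  | succ n ih =>
    obtain ⟨⟨w, hw⟩, y, hy, rfl⟩ := ih
    rw [(gasket_spec hα).2.2] at hy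
    obtain ⟨j, z, hz, rfl⟩ := Set.mem_iUnion.1 hy
    induction j using Fin.addCases (m := 3) (n := 3) with
    | left j => exact ⟨⟨j :: w, by simp [hw]⟩, z, hz, rfl⟩
    | right i =>
      refine absurd (Set.mem_iUnion.2 ⟨(w, i), ?_⟩) h2
      exact ⟨_, ⟨z, hz, rfl⟩, rfl⟩

theorem ediam_gasket_ne_top {α : ℝ} (hα : α ∈ Set.Ioo (0 : ℝ) (1 / 3)) :
    Metric.ediam (gasket hα) ≠ ∞ :=
  (gasket_spec hα).2.1.isBounded.ediam_ne_top

/-- Level $n$ covers the set by $3^n$ pieces of diameter at most $c^n\delta$, with $\delta$ the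
diameter of $K_\alpha$, and $3^n(c^n\delta)^{d_\alpha}=\delta^{d_\alpha}$ for every $n$. -/
theorem hausdorffMeasure_cantorPart_le {α : ℝ} (hα : α ∈ Set.Ioo (0 : ℝ) (1 / 3)) :
    MeasureTheory.Measure.hausdorffMeasure (gasketDim α) (cantorPart hα) ≤
      Metric.ediam (gasket hα) ^ gasketDim α := by
  have h0 := scale_pos hα
  have hd : 0 ≤ gasketDim α := by linarith [one_lt_gasketDim hα]
  set ρ : ℝ≥0 := Real.toNNReal ((1 - α) / 2) with hρ
  set δ := Metric.ediam (gasket hα) with hδ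
  have hρ1 : (ρ : ℝ≥0∞) < 1 := by
    rw [ENNReal.coe_lt_one_iff, hρ, Real.toNNReal_lt_one]
    exact scale_lt_one hα
  have hρd : (ρ : ℝ≥0∞) ^ gasketDim α = 3⁻¹ := by
    change ENNReal.ofReal ((1 - α) / 2) ^ gasketDim α = _
    rw [ENNReal.ofReal_rpow_of_nonneg h0.le hd, scale_rpow_gasketDim hα,
      ENNReal.ofReal_inv_of_pos (by norm_num)]
    simp
  have hdiam : ∀ n (w : List.Vector (Fin 3) n),
      Metric.ediam (wordMap α w.1 '' gasket hα) ≤ (ρ : ℝ≥0∞) ^ n * δ := by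
    intro n w
    have := (lipschitzWith_wordMap hα w.1).ediam_image_le (gasket hα)
    rwa [w.2, ENNReal.coe_pow] at this
  have hlim : Filter.Tendsto (fun n : ℕ => (ρ : ℝ≥0∞) ^ n * δ) Filter.atTop (nhds 0) := by
    have := ENNReal.Tendsto.mul_const (b := δ) (ENNReal.tendsto_pow_atTop_nhds_zero_of_lt_one hρ1)
      (Or.inr (ediam_gasket_ne_top hα))
    rwa [zero_mul] at this
  refine (MeasureTheory.Measure.hausdorffMeasure_le_liminf_sum (gasketDim α) (cantorPart hα)
    (fun n : ℕ => (ρ : ℝ≥0∞) ^ n * δ) hlim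
    (fun n (w : List.Vector (Fin 3) n) => wordMap α w.1 '' gasket hα)
    (.of_forall hdiam) (.of_forall fun n x hx => Set.mem_iUnion.2 (hx n))).trans ?_
  refine (Filter.liminf_le_liminf (v := fun _ : ℕ => δ ^ gasketDim α)
    (.of_forall fun n => ?_)).trans (le_of_eq (Filter.liminf_const _))
  calc ∑ w : List.Vector (Fin 3) n, Metric.ediam (wordMap α w.1 '' gasket hα) ^ gasketDim α
      ≤ ∑ _w : List.Vector (Fin 3) n, ((ρ : ℝ≥0∞) ^ n * δ) ^ gasketDim α :=
        Finset.sum_le_sum fun w _ => ENNReal.rpow_le_rpow (hdiam n w) hd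
    _ = δ ^ gasketDim α := by
        rw [Finset.sum_const, Finset.card_univ, card_vector, Fintype.card_fin, nsmul_eq_mul,
          ENNReal.mul_rpow_of_nonneg _ _ hd, ← ENNReal.rpow_natCast, ← ENNReal.rpow_mul,
          mul_comm (n : ℝ), ENNReal.rpow_mul, hρd, ENNReal.rpow_natCast, ← mul_assoc]
        push_cast
        rw [← mul_pow, ENNReal.mul_inv_cancel (by norm_num) (by norm_num), one_pow, one_mul]

/-- Hausdorff dimension is countably stable and there are only countably many joining pieces, each
of dimension at most $1<d_\alpha$. -/
theorem dimH_gasket_le {α : ℝ} (hα : α ∈ Set.Ioo (0 : ℝ) (1 / 3)) :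
    dimH (gasket hα) ≤ ENNReal.ofReal (gasketDim α) := by
  have h1 := one_lt_gasketDim hα
  refine (dimH_mono (gasket_subset hα)).trans ?_
  rw [dimH_union, dimH_iUnion]
  refine max_le ?_ (iSup_le fun q => (dimH_wordMap_joining_le hα q.1 q.2).trans ?_)
  · refine dimH_le_of_hausdorffMeasure_ne_top ?_
    rw [Real.coe_toNNReal _ (by linarith)]
    refine ((hausdorffMeasure_cantorPart_le hα).trans_lt ?_).ne
    exact ENNReal.rpow_lt_top_of_nonneg (by linarith) (ediam_gasket_ne_top hα)
  · rw [ENNReal.one_le_ofReal]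
    exact h1.le

end StretchedGasket

end

theorem mainTheorem3 (α : ℝ) (hα : α ∈ Set.Ioo (0 : ℝ) (1 / 3)) :
    (StretchedGasket.spectralTriple hα).dimension =
      ENNReal.ofReal (Real.log 3 / (Real.log 2 - Real.log (1 - α))) ∧
    dimH (StretchedGasket.gasket hα) =
      ENNReal.ofReal (Real.log 3 / (Real.log 2 - Real.log (1 - α))) :=
  ⟨StretchedGasket.spectralTriple_dimension hα,
    le_antisymm (StretchedGasket.dimH_gasket_le hα) (StretchedGasket.gasketDim_le_dimH hα)⟩
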